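/- Let $\Omega\subset\mathbb R^2$ be a (bounded, open, connected) polygonal domain and let $\mathscr T_h$ be a geometrically conforming triangulation of $\overline\Omega$ into closed triangles, with edge set $\mathscr E_h$. Let $V_h$ and $Z_h$ be the spaces of continuous functions on $\overline\Omega$ whose restriction to each triangle is a polynomial of degree at most $1$ and at most $2$, respectively, and let $\mathring V_h$, $\mathring Z_h$ be their subspaces of functions with $\int_\Omega v=0$. Write $(\cdot,\cdot)$ for the $L^2(\Omega)$ inner product and $\bar v=|\Omega|^{-1}(v,1)$. On an interior edge $e$ shared by triangles $K_\pm$, with unit normal $n_e$ pointing from $K_-$ to $K_+$, put $[\![\partial_n v]\!]=n_e\cdot(\nabla v_+-\nabla v_-)$ and $\{\!\{\partial_{nn}v\}\!\}=\tfrac12\,n_e\cdot(\nabla^2v_-+\nabla^2v_+)n_e$; on a boundary edge, with outer unit normal $n_e$, put $[\![\partial_n v]\!]=-n_e\cdot\nabla v$ and $\{\!\{\partial_{nn}v\}\!\}=n_e\cdot(\nabla^2v)n_e$. For a penalty parameter $\alpha$ let $$a_h(w,v)=\sum_{K\in\mathscr T_h}\int_K\nabla^2w:\nabla^2v\,dx+\sum_{e\in\mathscr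 E_h}\int_e\Big(\{\!\{\partial_{nn}w\}\!\}[\![\partial_n v]\!]+\{\!\{\partial_{nn}v\}\!\}[\![\partial_n w]\!]+\frac{\alpha}{|e|}[\![\partial_n w]\!][\![\partial_n v]\!]\Big)dS,$$ $$\|v\|_{2,h}^2=\sum_{K\in\mathscr T_h}|v|_{H^2(K)}^2+\sum_{e\in\mathscr E_h}\frac{\alpha}{|e|}\big\|[\![\partial_n v]\!]\big\|_{L^2(e)}^2 .$$ The triangulation is called shape regular with constant $\sigma$ if each triangle $K$ contains a disc of some diameter $d>0$ with $\operatorname{diam}K\le\sigma d$. For every $\sigma$ there is $\alpha_0\ge1$, depending only on $\sigma$, such that the following holds for every such $\Omega$, every such triangulation that is shape regular with constant $\sigma$ (of any mesh size $h$), every $\alpha\ge\alpha_0$, every time step $\tau>0$ and every $\epsilon<1$. 1. (Unique solvability of the fully discrete $C^0$ interior penalty scheme.) For every $\phi_h^{m-1}\in Z_h$ there is exactly one pair $(\phi_h^m,\mu_h^m)\in Z_h\times V_h$ such that for all $\nu_h\in V_h$ and $\psi_h\in Z_h$ $$\Big(\frac{\phi_h^m-\phi_h^{m-1}}\tau,\nu_h\Big)+(\nabla\mu_h^m,\nabla\nu_h)=0,$$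 $$a_h(\phi_h^m,\psi_h)+\big((\phi_h^m)^3+(1-\epsilon)\phi_h^m,\psi_h\big)-2(\nabla\phi_h^{m-1},\nabla\psi_h)-(\mu_h^m,\psi_h)=0.$$ 2. (Mean-zero scheme.) For every $\varphi_h^{m-1}\in\mathring Z_h$ and $c\in\mathbb R$ there is exactly one pair $(\varphi,\mu_\star)\in\mathring Z_h\times\mathring V_h$ such that $$(\ast)\quad a_h(\varphi,\psi_h)+\big((\varphi+c)^3,\psi_h\big)+(1-\epsilon)(\varphi+c,\psi_h)-(\mu_\star,\psi_h)=2(\nabla\varphi_h^{m-1},\nabla\psi_h)\quad\forall\psi_h\in\mathring Z_h,$$ $$(\ast\ast)\quad(\nabla\mu_\star,\nabla\nu_h)=-\Big(\frac{\varphi-\varphi_h^{m-1}}\tau,\nu_h\Big)\quad\forall\nu_h\in\mathring V_h.$$ 3. (Equivalence.) For $\phi_h^{m-1}\in Z_h$, let $c=\overline{\phi_h^{m-1}}$ and $\varphi_h^{m-1}=\phi_h^{m-1}-c$. Then $(\varphi,\mu_\star)\mapsto\big(\varphi+c,\ \mu_\star+\overline{(\varphi+c)^3+(1-\epsilon)(\varphi+c)}\big)$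 is a bijection from the solutions of the mean-zero scheme onto the solutions of the scheme in 1. 4. (Convex functional.) Let $X$ be $\mathring V_h$ or $\mathring Z_h$. For every $\zeta\in\mathring Z_h$ there is exactly one $\mathsf T_h\zeta\in X$ with $(\nabla\mathsf T_h\zeta,\nabla\chi)=(\zeta,\chi)$ for all $\chi\in X$; put $\|\zeta\|_{-1,h}^2=(\nabla\mathsf T_h\zeta,\nabla\mathsf T_h\zeta)$. For every $\varphi_h^{m-1}\in\mathring Z_h$ and $c\in\mathbb R$ the functional $$G_h(\varphi)=\frac\tau2\Big\|\frac{\varphi-\varphi_h^{m-1}}\tau\Big\|_{-1,h}^2+\frac12a_h(\varphi,\varphi)+\frac14\|\varphi+c\|_{L^4}^4+\frac{1-\epsilon}2\|\varphi+c\|_{L^2}^2-2(\nabla\varphi_h^{m-1},\nabla\varphi)$$ is strictly convex on $\mathring Z_h$, is coercive there (there are $\gamma>0$ and $\beta\ge0$ with $G_h(\varphi)\ge\gamma\|\varphi\|_{2,h}^2-\beta$ for all $\varphi\in\mathring Z_h$), and has a unique minimizer in $\mathring Z_h$. 5. (Minimization is the scheme.) For all $\varphi_h^{m-1},\varphi\in\mathring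 Z_h$ and $c\in\mathbb R$ there is exactly one $\mu_\star\in\mathring V_h$ satisfying $(\ast\ast)$; and, with $X=\mathring V_h$ in the definition of $G_h$, $\varphi$ minimizes $G_h$ over $\mathring Z_h$ if and only if $(\ast)$ holds with this $\mu_\star$. -/

import Mathlib

open MeasureTheory Measure Set

noncomputable section

/-- The Euclidean plane. -/
abbrev Plane : Type := EuclideanSpace ℝ (Fin 2)

/-- A (bounded, open, connected) polygonal domain: its boundary is a finite union of segments. -/
structure IsPolygonalDomain (Ω : Set Plane) : Prop where
  isOpen : IsOpen Ω
  isConnected : IsConnected Ω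
  isBounded : Bornology.IsBounded Ω
  polygonal : ∃ S : Finset (Plane × Plane), frontier Ω = ⋃ s ∈ S, segment ℝ s.1 s.2

/-- A geometrically conforming simplicial triangulation of `Ω`. A triangle is given by the set of
its three vertices; as a region of the plane it is the convex hull of the vertices. Two triangles
meet in the convex hull of their common vertices (nothing, a common vertex, or a common edge). -/
structure Triangulation (Ω : Set Plane) where
  triangles : Finset (Finset Plane)
  card_eq : ∀ t ∈ triangles, t.card = 3
  indep : ∀ t ∈ triangles, AffineIndependent ℝ ((↑) : t → Plane)
  conforming : ∀ s ∈ triangles, ∀ t ∈ triangles,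
    convexHull ℝ (s : Set Plane) ∩ convexHull ℝ (t : Set Plane) ⊆
      convexHull ℝ ((s : Set Plane) ∩ (t : Set Plane))
  cover : ⋃ t ∈ triangles, convexHull ℝ (t : Set Plane) = closure Ω

/-- The closed region spanned by a finite vertex set (a triangle or an edge). -/
def region (t : Finset Plane) : Set Plane := convexHull ℝ (t : Set Plane)

/-- `n` is a unit outer normal of the triangle `t` along its edge `e`: the triangle lies in the
half plane `⟪n, x - p⟫ ≤ 0` for each endpoint `p` of the edge. -/
def IsOuterNormal (t e : Finset Plane) (n : Plane) : Prop :=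
  ‖n‖ = 1 ∧ ∀ p ∈ e, ∀ x ∈ region t, inner ℝ n (x - p) ≤ 0

/-- The unit outer normal of the triangle `t` along its edge `e`. -/
def outerNormal (t e : Finset Plane) : Plane := Classical.epsilon (IsOuterNormal t e)

/-- Gradient on the triangle `t` of the restriction of `v` to `t` (one-sided up to the edges). -/
def grad (t : Finset Plane) (v : Plane → ℝ) (x : Plane) : Plane := gradientWithin v (region t) x

/-- Hessian on the triangle `t` of the restriction of `v` to `t`, as a bilinear form. -/
def hess (t : Finset Plane) (v : Plane → ℝ) (x : Plane) : Plane →L[ℝ] Plane →L[ℝ] ℝ :=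
  fderivWithin ℝ (fderivWithin ℝ v (region t)) (region t) x

/-- Frobenius product of the Hessians of `w` and `v` on the triangle `t`. -/
def hessProd (t : Finset Plane) (w v : Plane → ℝ) (x : Plane) : ℝ :=
  ∑ i : Fin 2, ∑ j : Fin 2,
    hess t w x (EuclideanSpace.single i 1) (EuclideanSpace.single j 1) *
      hess t v x (EuclideanSpace.single i 1) (EuclideanSpace.single j 1)

/-- Extension by zero to the plane of a continuous function on the closure of `Ω`. -/
def zeroExt {Ω : Set Plane} (v : C(closure Ω, ℝ)) : Plane → ℝ := Function.extend Subtype.val v 0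

/-- The `L²(Ω)` inner product. -/
def l2 {Ω : Set Plane} (u v : C(closure Ω, ℝ)) : ℝ := ∫ x in Ω, zeroExt u x * zeroExt v x

/-- The mean value over `Ω`. -/
def mean {Ω : Set Plane} (u : C(closure Ω, ℝ)) : ℝ := (volume.real Ω)⁻¹ * l2 u 1

/-- The constant function on the closure of `Ω`. -/
def cst {Ω : Set Plane} (c : ℝ) : C(closure Ω, ℝ) := ContinuousMap.const _ c

namespace Triangulation

variable {Ω : Set Plane} (T : Triangulation Ω)

/-- Shape regularity with constant `σ`: the ratio of the diameter of each triangle to the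
diameter of a disc contained in it is at most `σ`. -/
def ShapeRegular (σ : ℝ) : Prop :=
  ∀ t ∈ T.triangles, ∃ x : Plane, ∃ r : ℝ, 0 < r ∧ Metric.closedBall x r ⊆ region t ∧
    Metric.diam (region t) ≤ σ * (2 * r)

open scoped Classical in
/-- The set of the edges of the triangles. -/
def edges : Finset (Finset Plane) := T.triangles.biUnion fun t => t.powersetCard 2

open scoped Classical in
/-- The triangles having `e` as an edge: two for an interior edge, one for a boundary edge. -/
def adjacent (e : Finset Plane) : Finset (Finset Plane) := T.triangles.filter fun t => e ⊆ t

/-- The jump of the normal derivative across an edge, as a sum over the adjacent triangles with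
their own outer normals. On an interior edge, where `n` points from `K₋` to `K₊`, the outer normals
of `K₋`, `K₊` are `n`, `-n`, and this is `n · (∇v₊ - ∇v₋)`; on a boundary edge it is `-n · ∇v`. -/
def jump (e : Finset Plane) (v : Plane → ℝ) (x : Plane) : ℝ :=
  -∑ t ∈ T.adjacent e, inner ℝ (outerNormal t e) (grad t v x)

/-- The average of the second normal derivative `n · (∇²v) n` over the triangles adjacent to an
edge (on a boundary edge, the value from the only adjacent triangle). -/
def avg (e : Finset Plane) (v : Plane → ℝ) (x : Plane) : ℝ :=
  ((T.adjacent e).card : ℝ)⁻¹ *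
    ∑ t ∈ T.adjacent e, hess t v x (outerNormal t e) (outerNormal t e)

/-- The length of an edge. -/
def edgeLength (e : Finset Plane) : ℝ := Metric.diam (region e)

/-- The integral over an edge with respect to arc length. -/
def edgeIntegral (e : Finset Plane) (f : Plane → ℝ) : ℝ := ∫ x in region e, f x ∂μH[1]

/-- The `C⁰` interior penalty bilinear form with penalty parameter `α`. -/
def aIP (α : ℝ) (w v : C(closure Ω, ℝ)) : ℝ :=
  (∑ t ∈ T.triangles, (∫ x in region t, hessProd t (zeroExt w) (zeroExt v) x))
  + (∑ e ∈ T.edges, edgeIntegral e (fun x => T.avg e (zeroExt w) x * T.jump e (zeroExt v) x))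
  + (∑ e ∈ T.edges, edgeIntegral e (fun x => T.avg e (zeroExt v) x * T.jump e (zeroExt w) x))
  + α * ∑ e ∈ T.edges, (edgeLength e)⁻¹ *
      edgeIntegral e (fun x => T.jump e (zeroExt w) x * T.jump e (zeroExt v) x)

/-- The square of the mesh dependent norm `‖·‖_{2,h}`. -/
def norm2hSq (α : ℝ) (v : C(closure Ω, ℝ)) : ℝ :=
  (∑ t ∈ T.triangles, (∫ x in region t, hessProd t (zeroExt v) (zeroExt v) x))
  + ∑ e ∈ T.edges, α / edgeLength e * edgeIntegral e (fun x => T.jump e (zeroExt v) x ^ 2)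

/-- `(∇u, ∇v)` for continuous functions that are polynomial on each triangle: their weak gradient
is the gradient taken triangle by triangle. -/
def gradIP (u v : C(closure Ω, ℝ)) : ℝ :=
  ∑ t ∈ T.triangles, (∫ x in region t, inner ℝ (grad t (zeroExt u) x) (grad t (zeroExt v) x))

/-- Continuous functions on the closure of `Ω` that are polynomials of degree at most `k` on each
triangle (the Lagrange finite element space of degree `k`). -/
def feSpace (k : ℕ) : Set C(closure Ω, ℝ) :=
  {v | ∀ t ∈ T.triangles, ∃ p : MvPolynomial (Fin 2) ℝ, p.totalDegree ≤ k ∧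
    ∀ x : closure Ω, (x : Plane) ∈ region t → v x = p.eval (fun i => (x : Plane) i)}

/-- `V_h`: continuous piecewise `P₁` functions. -/
def V : Set C(closure Ω, ℝ) := T.feSpace 1

/-- `Z_h`: continuous piecewise `P₂` functions. -/
def Z : Set C(closure Ω, ℝ) := T.feSpace 2

/-- The functions of `V_h` with mean zero. -/
def V₀ : Set C(closure Ω, ℝ) := {v | v ∈ T.V ∧ l2 v 1 = 0}

/-- The functions of `Z_h` with mean zero. -/
def Z₀ : Set C(closure Ω, ℝ) := {v | v ∈ T.Z ∧ l2 v 1 = 0}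

/-- `χ` is the discrete inverse Laplacian of `ζ` in the mean-zero space `X`. -/
def IsInvLaplacian (X : Set C(closure Ω, ℝ)) (ζ χ : C(closure Ω, ℝ)) : Prop :=
  χ ∈ X ∧ ∀ η ∈ X, T.gradIP χ η = l2 ζ η

/-- The discrete inverse Laplacian `T_h ζ` with values in the mean-zero space `X`. -/
def invLaplacian (X : Set C(closure Ω, ℝ)) (ζ : C(closure Ω, ℝ)) : C(closure Ω, ℝ) :=
  Classical.epsilon (T.IsInvLaplacian X ζ)

/-- The square of the discrete negative norm, `‖ζ‖²_{-1,h} = (∇ T_h ζ, ∇ T_h ζ)`. -/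
def negNormSq (X : Set C(closure Ω, ℝ)) (ζ : C(closure Ω, ℝ)) : ℝ :=
  T.gradIP (T.invLaplacian X ζ) (T.invLaplacian X ζ)

/-- The functional `G_h`, with the negative norm taken through `T_h` with values in `X`; `c` is the
prescribed mean value and `φp` the mean-zero part of the previous time level. -/
def G (X : Set C(closure Ω, ℝ)) (α τ ε c : ℝ) (φp φ : C(closure Ω, ℝ)) : ℝ :=
  τ / 2 * T.negNormSq X (τ⁻¹ • (φ - φp)) + 1 / 2 * T.aIP α φ φ
  + 1 / 4 * (∫ x in Ω, |zeroExt (φ + cst c) x| ^ 4)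
  + (1 - ε) / 2 * (∫ x in Ω, |zeroExt (φ + cst c) x| ^ 2)
  - 2 * T.gradIP φp φ

/-- The second equation of the mean-zero scheme, for `μ ∈ V₀`. -/
def MeanZeroEqMu (τ : ℝ) (φp φ μ : C(closure Ω, ℝ)) : Prop :=
  ∀ ν ∈ T.V₀, T.gradIP μ ν = -l2 (τ⁻¹ • (φ - φp)) ν

/-- The first equation of the mean-zero scheme. -/
def MeanZeroEqPhi (α ε c : ℝ) (φp φ μ : C(closure Ω, ℝ)) : Prop :=
  ∀ ψ ∈ T.Z₀, T.aIP α φ ψ + l2 ((φ + cst c) ^ 3) ψ + (1 - ε) * l2 (φ + cst c) ψ - l2 μ ψ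
    = 2 * T.gradIP φp ψ

/-- The solutions `(φ, μ) ∈ Z₀ × V₀` of the mean-zero scheme. -/
def meanZeroSolutions (α τ ε c : ℝ) (φp : C(closure Ω, ℝ)) :
    Set (C(closure Ω, ℝ) × C(closure Ω, ℝ)) :=
  {s | s.1 ∈ T.Z₀ ∧ s.2 ∈ T.V₀ ∧
    T.MeanZeroEqPhi α ε c φp s.1 s.2 ∧ T.MeanZeroEqMu τ φp s.1 s.2}

/-- The solutions `(φ, μ) ∈ Z_h × V_h` of one time step of the fully discrete convex-splitting
`C⁰` interior penalty scheme, `φp` being the previous time level. -/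
def schemeSolutions (α τ ε : ℝ) (φp : C(closure Ω, ℝ)) :
    Set (C(closure Ω, ℝ) × C(closure Ω, ℝ)) :=
  {s | s.1 ∈ T.Z ∧ s.2 ∈ T.V ∧
    (∀ ν ∈ T.V, l2 (τ⁻¹ • (s.1 - φp)) ν + T.gradIP s.2 ν = 0) ∧
    ∀ ψ ∈ T.Z, T.aIP α s.1 ψ + l2 (s.1 ^ 3 + (1 - ε) • s.1) ψ - 2 * T.gradIP φp ψ - l2 s.2 ψ = 0}

/-- The correspondence `(φ, μ) ↦ (φ + c, μ + m)`, where `m` is the mean value of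
`(φ + c)³ + (1 - ε)(φ + c)`. -/
def lift (ε c : ℝ) (s : C(closure Ω, ℝ) × C(closure Ω, ℝ)) :
    C(closure Ω, ℝ) × C(closure Ω, ℝ) :=
  (s.1 + cst c, s.2 + cst (mean ((s.1 + cst c) ^ 3 + (1 - ε) • (s.1 + cst c))))

end Triangulation

end

/-! One time step is the Euler-Lagrange equation of a strictly convex energy on a finite-dimensional
space. On mean-zero piecewise quadratics `G` equals `1/2 B(φ,φ) + ℓ(φ) + 1/4 ∫(φ+c)⁴ + C`, where `B
= τ⁻¹ N + a_h + (1-ε)(·,·)` and `N(u,v) = (∇T_h u, ∇T_h v)`. The form `N` is nonnegative, `a_h` is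
nonnegative for large `α`, and the `L²` term is definite because `ε < 1`. A definite quadratic form
plus an affine function plus a nonnegative convex function is strictly convex and grows at infinity,
so it has exactly one minimizer, characterized by a vanishing derivative (`IsSplitEnergy`). The
linear part is absorbed by the `L²` term alone, so no Poincaré inequality for `‖·‖_{2,h}` is needed.

The analytic core is `half_norm2hSq_le_aIP`. Hessians of piecewise quadratics are constant on each
triangle, so their edge averages are controlled by the `H²` seminorms through a comparison of
squared edge length with area, which is shape regularity. Young's inequality then absorbs the mixed
edge terms into the Hessian and penalty terms.

The operator `T_h` exists because `(∇u,∇u) = 0` forces a continuous piecewise quadratic to be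
constant on the connected `Ω`, hence zero if its mean vanishes. With `X = V₀`, equation (∗∗) says `μ
= -T_h((φ-φp)/τ)`, which turns the derivative of the negative norm into the term `-(μ,ψ)` of (∗).

The two schemes are equivalent because constants lie in the kernel of both `a_h` and `(∇·,∇·)`:
testing with `1` fixes the means of `φ` and `μ`, and the remaining content of the equations is the
mean-zero scheme. -/

/-! ### Integration over the domain as a linear functional on continuous functions. -/

section OmegaIntegral

variable {Ω : Set Plane}

lemma zeroExt_coe (v : C(closure Ω, ℝ)) (x : closure Ω) : zeroExt v x = v x :=
  Subtype.val_injective.extend_apply _ _ _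

lemma zeroExt_of_mem (v : C(closure Ω, ℝ)) {x : Plane} (hx : x ∈ closure Ω) :
    zeroExt v x = v ⟨x, hx⟩ := zeroExt_coe v ⟨x, hx⟩

lemma zeroExt_of_notMem (v : C(closure Ω, ℝ)) {x : Plane} (hx : x ∉ closure Ω) :
    zeroExt v x = 0 := by
  unfold zeroExt
  rw [Function.extend_apply']
  · rfl
  · rintro ⟨a, rfl⟩
    exact hx a.2

lemma zeroExt_add (u v : C(closure Ω, ℝ)) : zeroExt (u + v) = zeroExt u + zeroExt v := by
  ext x
  by_cases hx : x ∈ closure Ω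
  · simp [zeroExt_of_mem _ hx]
  · simp [zeroExt_of_notMem _ hx]

lemma zeroExt_smul (a : ℝ) (v : C(closure Ω, ℝ)) : zeroExt (a • v) = a • zeroExt v := by
  ext x
  by_cases hx : x ∈ closure Ω
  · simp [zeroExt_of_mem _ hx]
  · simp [zeroExt_of_notMem _ hx]

lemma zeroExt_mul (u v : C(closure Ω, ℝ)) : zeroExt (u * v) = zeroExt u * zeroExt v := by
  ext x
  by_cases hx : x ∈ closure Ω
  · simp [zeroExt_of_mem _ hx]
  · simp [zeroExt_of_notMem _ hx]

lemma continuousOn_zeroExt (v : C(closure Ω, ℝ)) : ContinuousOn (zeroExt v) (closure Ω) := by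
  rw [continuousOn_iff_continuous_domRestrict]
  convert v.continuous using 1
  ext x
  exact zeroExt_coe v x

lemma integrableOn_zeroExt (hb : Bornology.IsBounded Ω) (v : C(closure Ω, ℝ)) :
    IntegrableOn (zeroExt v) Ω :=
  ((continuousOn_zeroExt v).integrableOn_compact hb.isCompact_closure).mono_set subset_closure

/-- Integration over a bounded set as a linear functional. -/
noncomputable def omegaIntegral (hb : Bornology.IsBounded Ω) : C(closure Ω, ℝ) →ₗ[ℝ] ℝ where
  toFun v := ∫ x in Ω, zeroExt v x
  map_add' u v := by
    rw [zeroExt_add]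
    exact integral_add (integrableOn_zeroExt hb u) (integrableOn_zeroExt hb v)
  map_smul' a v := by
    rw [zeroExt_smul]
    exact integral_const_mul a _

lemma omegaIntegral_apply (hb : Bornology.IsBounded Ω) (v : C(closure Ω, ℝ)) :
    omegaIntegral hb v = ∫ x in Ω, zeroExt v x := rfl

lemma l2_eq (hb : Bornology.IsBounded Ω) (u v : C(closure Ω, ℝ)) :
    l2 u v = omegaIntegral hb (u * v) := by
  rw [omegaIntegral_apply, zeroExt_mul]
  rfl

lemma omegaIntegral_nonneg (hb : Bornology.IsBounded Ω) {v : C(closure Ω, ℝ)} (hv : ∀ x, 0 ≤ v x) :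
    0 ≤ omegaIntegral hb v := by
  refine integral_nonneg fun x => ?_
  by_cases hx : x ∈ closure Ω
  · simp [zeroExt_of_mem _ hx, hv]
  · simp [zeroExt_of_notMem _ hx]

/-- The square vanishes almost everywhere on the open set, hence everywhere on it by continuity,
hence on the closure by density. -/
lemma eq_zero_of_omegaIntegral_mul_self (hb : Bornology.IsBounded Ω) (ho : IsOpen Ω)
    {v : C(closure Ω, ℝ)} (hv : omegaIntegral hb (v * v) = 0) : v = 0 := by
  have h0 : 0 ≤ᵐ[volume.restrict Ω] zeroExt (v * v) := by
    refine Filter.Eventually.of_forall fun x => ?_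
    rw [zeroExt_mul]
    exact mul_self_nonneg _
  have h1 := (setIntegral_eq_zero_iff_of_nonneg_ae h0 (integrableOn_zeroExt hb _)).1 hv
  have h2 : EqOn (zeroExt (v * v)) 0 Ω :=
    eqOn_of_ae_eq h1 ((continuousOn_zeroExt _).mono subset_closure) continuousOn_const
      (by rw [ho.interior_eq]; exact subset_closure)
  have h3 : EqOn (zeroExt (v * v)) 0 (closure Ω) :=
    h2.of_subset_closure (continuousOn_zeroExt _) continuousOn_const subset_closure subset_rfl
  ext x
  have := h3 x.2
  rw [zeroExt_coe] at this
  simpa using this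

lemma omegaIntegral_cst (hb : Bornology.IsBounded Ω) (ho : IsOpen Ω) (c : ℝ) :
    omegaIntegral hb (cst c) = volume.real Ω * c := by
  have : omegaIntegral hb (cst c : C(closure Ω, ℝ)) = ∫ x in Ω, c :=
    setIntegral_congr_fun ho.measurableSet fun x hx => zeroExt_of_mem _ (subset_closure hx)
  rw [this]
  simp

lemma cst_eq_smul (c : ℝ) : (cst c : C(closure Ω, ℝ)) = c • 1 := by
  ext x
  simp [cst]

end OmegaIntegral

/-! ### Quadratic polynomials and their one-sided derivatives. -/

section Quadratic

/-- `f` agrees on `s` with a polynomial of degree at most two. -/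
def IsQuadOn (f : Plane → ℝ) (s : Set Plane) : Prop :=
  ∃ (c : ℝ) (A : Plane →L[ℝ] ℝ) (B : Plane →L[ℝ] Plane →L[ℝ] ℝ), ∀ x ∈ s, f x = c + A x + B x x

lemma IsQuadOn.add {f g : Plane → ℝ} {s : Set Plane} (hf : IsQuadOn f s) (hg : IsQuadOn g s) :
    IsQuadOn (f + g) s := by
  obtain ⟨c, A, B, h⟩ := hf
  obtain ⟨c', A', B', h'⟩ := hg
  refine ⟨c + c', A + A', B + B', fun x hx => ?_⟩
  simp [h x hx, h' x hx]
  ring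

lemma IsQuadOn.const_mul {f : Plane → ℝ} {s : Set Plane} (a : ℝ) (hf : IsQuadOn f s) :
    IsQuadOn (fun x => a * f x) s := by
  obtain ⟨c, A, B, h⟩ := hf
  refine ⟨a * c, a • A, a • B, fun x hx => ?_⟩
  simp [h x hx]
  ring

lemma isQuadOn_monomial (s : Set Plane) (m n : ℕ) (h : m + n ≤ 2) :
    IsQuadOn (fun x => x 0 ^ m * x 1 ^ n) s := by
  let p : Fin 2 → Plane →L[ℝ] ℝ := fun i => EuclideanSpace.proj i
  let P : Fin 2 → Fin 2 → Plane →L[ℝ] Plane →L[ℝ] ℝ := fun i j => (p i).smulRight (p j)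
  have hp : ∀ i x, p i x = x i := fun i x => rfl
  have hP : ∀ i j x, P i j x x = x i * x j := fun i j x => rfl
  have hm : m ≤ 2 := by omega
  have hn : n ≤ 2 := by omega
  interval_cases m <;> interval_cases n <;> first | omega | skip
  · exact ⟨1, 0, 0, fun x _ => by simp⟩
  · exact ⟨0, p 1, 0, fun x _ => by simp [hp]⟩
  · exact ⟨0, 0, P 1 1, fun x _ => by simp [hP]; ring⟩
  · exact ⟨0, p 0, 0, fun x _ => by simp [hp]⟩
  · exact ⟨0, 0, P 0 1, fun x _ => by simp [hP]⟩
  · exact ⟨0, 0, P 0 0, fun x _ => by simp [hP]; ring⟩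

lemma isQuadOn_eval (s : Set Plane) {p : MvPolynomial (Fin 2) ℝ} (hp : p.totalDegree ≤ 2) :
    IsQuadOn (fun x => p.eval fun i => x i) s := by
  have : (fun x : Plane => p.eval fun i => x i)
      = ∑ d ∈ p.support, fun x : Plane => p.coeff d * (x 0 ^ d 0 * x 1 ^ d 1) := by
    ext x
    simp [MvPolynomial.eval_eq', Fin.prod_univ_two]
  rw [this]
  refine Finset.sum_induction _ (IsQuadOn · s) (fun _ _ => IsQuadOn.add)
    ⟨0, 0, 0, fun x _ => by simp⟩ fun d hd => (isQuadOn_monomial s _ _ ?_).const_mul _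
  have := (MvPolynomial.le_totalDegree hd).trans hp
  rwa [Finsupp.sum_fintype _ _ (fun _ => rfl), Fin.sum_univ_two] at this

variable {s : Set Plane} {f g : Plane → ℝ}

lemma IsQuadOn.congr (hf : IsQuadOn f s) (h : EqOn g f s) : IsQuadOn g s := by
  obtain ⟨c, A, B, hq⟩ := hf
  exact ⟨c, A, B, fun x hx => (h hx).trans (hq x hx)⟩

lemma hasFDerivAt_quad (c : ℝ) (A : Plane →L[ℝ] ℝ) (B : Plane →L[ℝ] Plane →L[ℝ] ℝ) (x : Plane) :
    HasFDerivAt (fun x => c + A x + B x x) (A + (B + B.flip) x) x := by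
  have h := ((A.hasFDerivAt (x := x)).const_add c).add
    ((B.hasFDerivAt (x := x)).clm_apply (hasFDerivAt_id x))
  refine h.congr_fderiv ?_
  ext y
  simp

/-- The second derivative `D` does not depend on the point. This constancy is what later makes the
discrete trace inequality elementary. -/
lemma IsQuadOn.exists_fderivWithin (hs : UniqueDiffOn ℝ s) (hf : IsQuadOn f s) :
    ∃ (A : Plane →L[ℝ] ℝ) (D : Plane →L[ℝ] Plane →L[ℝ] ℝ),
      ∀ x ∈ s, HasFDerivWithinAt f (A + D x) s x ∧ fderivWithin ℝ f s x = A + D x ∧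
        fderivWithin ℝ (fderivWithin ℝ f s) s x = D := by
  obtain ⟨c, A, B, h⟩ := hf
  have h1 : ∀ x ∈ s, HasFDerivWithinAt f (A + (B + B.flip) x) s x := fun x hx =>
    ((hasFDerivAt_quad c A B x).hasFDerivWithinAt).congr h (h x hx)
  have h2 : ∀ x ∈ s, fderivWithin ℝ f s x = A + (B + B.flip) x := fun x hx =>
    (h1 x hx).fderivWithin (hs x hx)
  refine ⟨A, B + B.flip, fun x hx => ⟨h1 x hx, h2 x hx, ?_⟩⟩
  rw [fderivWithin_congr h2 (h2 x hx)]
  exact ((((B + B.flip).hasFDerivAt (x := x)).const_add A).hasFDerivWithinAt).fderivWithin (hs x hx)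

lemma IsQuadOn.differentiableOn (hs : UniqueDiffOn ℝ s) (hf : IsQuadOn f s) :
    DifferentiableOn ℝ f s := by
  obtain ⟨A, D, h⟩ := hf.exists_fderivWithin hs
  exact fun x hx => (h x hx).1.differentiableWithinAt

lemma IsQuadOn.continuousOn_fderivWithin (hs : UniqueDiffOn ℝ s) (hf : IsQuadOn f s) :
    ContinuousOn (fderivWithin ℝ f s) s := by
  obtain ⟨A, D, h⟩ := hf.exists_fderivWithin hs
  exact (by fun_prop : ContinuousOn (fun x => A + D x) s).congr fun x hx => (h x hx).2.1

lemma IsQuadOn.differentiableOn_fderivWithin (hs : UniqueDiffOn ℝ s) (hf : IsQuadOn f s) :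
    DifferentiableOn ℝ (fderivWithin ℝ f s) s := by
  obtain ⟨A, D, h⟩ := hf.exists_fderivWithin hs
  exact (by fun_prop : DifferentiableOn ℝ (fun x => A + D x) s).congr fun x hx => (h x hx).2.1

end Quadratic

/-! ### Minimization of convex energies in finite dimension. -/

section Energy

variable {E : Type*} [NormedAddCommGroup E] [NormedSpace ℝ E]

/-- Riesz representation for a positive definite bilinear form on a finite dimensional space. -/
lemma existsUnique_riesz {E : Type*} [AddCommGroup E] [Module ℝ E] [FiniteDimensional ℝ E]
    {P : E →ₗ[ℝ] E →ₗ[ℝ] ℝ} (hP : ∀ v, P v v = 0 → v = 0) (ℓ : E →ₗ[ℝ] ℝ) :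
    ∃! w, P w = ℓ := by
  have hinj : Function.Injective (P : E →ₗ[ℝ] Module.Dual ℝ E) := by
    rw [injective_iff_map_eq_zero]
    intro v hv
    exact hP v (by rw [hv]; rfl)
  have hsurj := (LinearMap.injective_iff_surjective_of_finrank_eq_finrank
    (Subspace.dual_finrank_eq (K := ℝ) (V := E)).symm).1 hinj
  obtain ⟨w, hw⟩ := hsurj ℓ
  exact ⟨w, hw, fun w' hw' => hinj (hw'.trans hw.symm)⟩

/-- The constant is the minimum of the form on the compact unit sphere, extended by homogeneity. -/
lemma exists_pos_mul_sq_norm_le [FiniteDimensional ℝ E]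
    {P : E →ₗ[ℝ] E →ₗ[ℝ] ℝ} (hP : ∀ v, v ≠ 0 → 0 < P v v) :
    ∃ m : ℝ, 0 < m ∧ ∀ v, m * ‖v‖ ^ 2 ≤ P v v := by
  have hc : Continuous fun v => P v v := by
    have h1 : Continuous fun v => LinearMap.toContinuousLinearMap (P v) :=
      (LinearMap.toContinuousLinearMap.toLinearMap ∘ₗ P).continuous_of_finiteDimensional
    exact h1.clm_apply continuous_id
  have : ProperSpace E := FiniteDimensional.proper ℝ E
  -- The sphere is empty exactly when the space is trivial, and then any constant works.
  rcases (Metric.sphere (0 : E) 1).eq_empty_or_nonempty with h0 | h0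
  · refine ⟨1, one_pos, fun v => ?_⟩
    by_cases hv : v = 0
    · simp [hv]
    · have : ‖v‖⁻¹ • v ∈ Metric.sphere (0 : E) 1 := by
        simp [norm_smul, norm_ne_zero_iff.2 hv]
      simp [h0] at this
  obtain ⟨x, hx, hmin⟩ := (isCompact_sphere (0 : E) 1).exists_isMinOn h0 hc.continuousOn
  have hx0 : x ≠ 0 := by
    rintro rfl
    simp at hx
  refine ⟨P x x, hP x hx0, fun v => ?_⟩
  by_cases hv : v = 0
  · simp [hv]
  have hn := norm_ne_zero_iff.2 hv
  have hs : ‖v‖⁻¹ • v ∈ Metric.sphere (0 : E) 1 := by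
    simp [norm_smul, hn]
  have := hmin hs
  simp only [mem_ofPred_eq, map_smul, LinearMap.smul_apply, smul_eq_mul] at this
  calc P x x * ‖v‖ ^ 2 ≤ (‖v‖⁻¹ * (‖v‖⁻¹ * P v v)) * ‖v‖ ^ 2 := by gcongr
    _ = P v v := by field_simp

/-- Completing the square in `‖v‖`, using the lower bound `m ‖v‖²` and the operator norm of `ℓ`. -/
lemma exists_neg_le_quadratic_add_linear [FiniteDimensional ℝ E]
    {P : E →ₗ[ℝ] E →ₗ[ℝ] ℝ} (hP : ∀ v, v ≠ 0 → 0 < P v v)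
    {k : ℝ} (hk : 0 < k) (ℓ : E →ₗ[ℝ] ℝ) : ∃ β : ℝ, 0 ≤ β ∧ ∀ v, -β ≤ k * P v v + ℓ v := by
  obtain ⟨m, hm, hmv⟩ := exists_pos_mul_sq_norm_le hP
  set L := LinearMap.toContinuousLinearMap ℓ
  refine ⟨‖L‖ ^ 2 / (4 * (k * m)), by positivity, fun v => ?_⟩
  have h1 : -(‖L‖ * ‖v‖) ≤ ℓ v := (abs_le.1 (L.le_opNorm v)).1
  have h2 := mul_le_mul_of_nonneg_left (hmv v) hk.le
  have hkm : 0 < k * m := by positivity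
  have h3 : -(‖L‖ ^ 2 / (4 * (k * m))) ≤ k * m * ‖v‖ ^ 2 - ‖L‖ * ‖v‖ := by
    rw [neg_le_iff_add_nonneg]
    have : k * m * ‖v‖ ^ 2 - ‖L‖ * ‖v‖ + ‖L‖ ^ 2 / (4 * (k * m))
        = (2 * (k * m) * ‖v‖ - ‖L‖) ^ 2 / (4 * (k * m)) := by
      field_simp
      ring
    rw [this]
    positivity
  linarith

/-- A functional that is the sum of a positive definite quadratic form, an affine function and a
nonnegative convex function `Q` with derivative `D`. -/
structure IsSplitEnergy (G : E → ℝ) (B : E →ₗ[ℝ] E →ₗ[ℝ] ℝ) (ℓ : E →ₗ[ℝ] ℝ) (Q : E → ℝ)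
    (D : E → E →ₗ[ℝ] ℝ) (C : ℝ) : Prop where
  symm : ∀ u v, B u v = B v u
  pos : ∀ v, v ≠ 0 → 0 < B v v
  nonneg : ∀ v, 0 ≤ Q v
  convex : ∀ z w, Q z + D z w ≤ Q (z + w)
  smooth : ∀ z w, ∃ M : ℝ, ∀ s : ℝ, 0 ≤ s → s ≤ 1 → Q (z + s • w) ≤ Q z + s * D z w + s ^ 2 * M
  eq : ∀ v, G v = 1 / 2 * B v v + ℓ v + Q v + C

namespace IsSplitEnergy

variable {G : E → ℝ} {B : E →ₗ[ℝ] E →ₗ[ℝ] ℝ} {ℓ : E →ₗ[ℝ] ℝ} {Q : E → ℝ}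
  {D : E → E →ₗ[ℝ] ℝ} {C : ℝ}

/-- The graph lies strictly above its tangent plane: `Q` contributes the weak inequality and `1/2
B(w,w) > 0` the strictness. Convexity and uniqueness both follow from this. -/
lemma lt_add (h : IsSplitEnergy G B ℓ Q D C) (z : E) {w : E} (hw : w ≠ 0) :
    G z + (B z w + ℓ w + D z w) < G (z + w) := by
  rw [h.eq, h.eq]
  have h1 := h.pos w hw
  have h2 := h.convex z w
  have h3 := h.symm z w
  simp only [map_add, LinearMap.add_apply]
  linarith

lemma strictConvexOn (h : IsSplitEnergy G B ℓ Q D C) : StrictConvexOn ℝ univ G := by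
  refine ⟨convex_univ, fun x _ y _ hxy a b ha hb hab => ?_⟩
  obtain rfl : b = 1 - a := by linarith
  -- Tangent inequalities at the convex combination `z`, weighted by `a` and `1 - a`; the derivative
  -- terms then cancel.
  set z := a • x + (1 - a) • y with hz
  have hx : x - z = (1 - a) • (x - y) := by rw [hz]; module
  have hy : y - z = (-a) • (x - y) := by rw [hz]; module
  have hne : x - y ≠ 0 := sub_ne_zero.2 hxy
  have h1 := h.lt_add z (w := x - z) (by rw [hx]; exact smul_ne_zero hb.ne' hne)
  have h2 := h.lt_add z (w := y - z) (by rw [hy]; exact smul_ne_zero (neg_ne_zero.2 ha.ne') hne)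
  rw [add_sub_cancel, hx] at h1
  rw [add_sub_cancel, hy] at h2
  simp only [map_smul, smul_eq_mul] at h1 h2 ⊢
  nlinarith [mul_lt_mul_of_pos_left h1 ha, mul_lt_mul_of_pos_left h2 hb]

lemma isMinOn_iff (h : IsSplitEnergy G B ℓ Q D C) (z : E) :
    (∀ y, G z ≤ G y) ↔ ∀ w, B z w + ℓ w + D z w = 0 := by
  constructor
  · intro hmin
    have key : ∀ w, 0 ≤ B z w + ℓ w + D z w := by
      intro w
      obtain ⟨M, hM⟩ := h.smooth z w
      by_contra! hneg
      set d := B z w + ℓ w + D z w with hd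
      -- Along `w` the energy changes by at most `s d + s² R`. The step `s` below gives `s R ≤ -d /
      -- 2`, so the change would be negative. The lower bound `1` on `R` keeps the quotient
      -- meaningful.
      set R := max (1 / 2 * B w w + M) 1
      have hR : 1 ≤ R := le_max_right _ _
      have hR' : 1 / 2 * B w w + M ≤ R := le_max_left _ _
      set s := min 1 (-d / (2 * R)) with hs
      have hs0 : 0 < s := lt_min one_pos (div_pos (by linarith) (by linarith))
      have hs1 : s ≤ 1 := min_le_left _ _
      have hs2 : s * (2 * R) ≤ -d := by
        rw [← le_div_iff₀ (by linarith)]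
        exact min_le_right _ _
      have h1 := hmin (z + s • w)
      have h2 := hM s hs0.le hs1
      have h3 := h.symm z w
      rw [h.eq, h.eq] at h1
      simp only [map_add, map_smul, LinearMap.add_apply, LinearMap.smul_apply, smul_eq_mul] at h1
      have h4 : 0 ≤ s * (d + s * R) := by
        have : s * (s * (1 / 2 * B w w + M)) ≤ s * (s * R) := by gcongr
        rw [hd]
        rw [h3] at h1 ⊢
        linarith
      nlinarith [mul_pos hs0 hs0]
    intro w
    have h1 := key w
    have h2 := key (-w)
    simp only [map_neg] at h2
    linarith
  · intro hz y
    by_cases hy : y - z = 0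
    · rw [sub_eq_zero.1 hy]
    · have := h.lt_add z hy
      rw [hz, add_zero, add_sub_cancel] at this
      exact this.le

lemma existsUnique_min [FiniteDimensional ℝ E] (h : IsSplitEnergy G B ℓ Q D C) : ∃! z, ∀ y, G z ≤ G y := by
  have hcont : Continuous G := by
    rw [← continuousOn_univ]
    exact h.strictConvexOn.convexOn.continuousOn isOpen_univ
  obtain ⟨m, hm, hmv⟩ := exists_pos_mul_sq_norm_le h.pos
  -- Half of the quadratic part absorbs `ℓ`; the other half provides growth at infinity.
  obtain ⟨β, -, hβ⟩ := exists_neg_le_quadratic_add_linear h.pos (k := 1 / 4) (by norm_num) ℓ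
  have : ProperSpace E := FiniteDimensional.proper ℝ E
  have htend : Filter.Tendsto G (Filter.cocompact E) Filter.atTop := by
    have h1 : Filter.Tendsto (fun v : E => 1 / 4 * m * ‖v‖ ^ 2 + (C - β)) (Filter.cocompact E)
        Filter.atTop :=
      Filter.tendsto_atTop_add_const_right _ _
        (((Filter.tendsto_pow_atTop two_ne_zero).comp (tendsto_norm_cocompact_atTop (E := E))
          ).const_mul_atTop (by positivity))
    refine Filter.tendsto_atTop_mono (fun v => ?_) h1
    rw [h.eq]
    linarith [hβ v, hmv v, h.nonneg v]
  obtain ⟨z, hz⟩ := hcont.exists_forall_le htend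
  refine ⟨z, hz, fun y hy => ?_⟩
  by_contra hne
  have h1 := h.lt_add z (sub_ne_zero.2 hne)
  rw [(h.isMinOn_iff z).1 hz, add_zero, add_sub_cancel] at h1
  exact absurd (hy z) (not_le.2 h1)

/-- If the quadratic part dominates `n` plus a positive definite form, then so does the energy. -/
lemma coercive [FiniteDimensional ℝ E] (h : IsSplitEnergy G B ℓ Q D C) {P : E →ₗ[ℝ] E →ₗ[ℝ] ℝ}
    (hP : ∀ v, v ≠ 0 → 0 < P v v) {n : E → ℝ} (hn : ∀ v, n v + P v v ≤ B v v) :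
    ∃ β : ℝ, 0 ≤ β ∧ ∀ v, 1 / 2 * n v - β ≤ G v := by
  obtain ⟨β, h0, hβ⟩ := exists_neg_le_quadratic_add_linear hP (k := 1 / 2) (by norm_num) ℓ
  refine ⟨β + |C|, by positivity, fun v => ?_⟩
  rw [h.eq]
  linarith [hβ v, hn v, h.nonneg v, neg_abs_le C]

end IsSplitEnergy

end Energy

/-! ### Bilinearity of integrals and sums of products. -/

section Bilinear

variable {E : Type*} [AddCommGroup E] [Module ℝ E]

/-- The function `b` of two arguments is bilinear. -/
def IsBilin (b : E → E → ℝ) : Prop := ∃ B : E →ₗ[ℝ] E →ₗ[ℝ] ℝ, ∀ u v, b u v = B u v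

lemma IsBilin.add {b b' : E → E → ℝ} (h : IsBilin b) (h' : IsBilin b') :
    IsBilin fun u v => b u v + b' u v := by
  obtain ⟨B, hB⟩ := h
  obtain ⟨B', hB'⟩ := h'
  exact ⟨B + B', fun u v => by simp [hB, hB']⟩

lemma IsBilin.const_mul {b : E → E → ℝ} (a : ℝ) (h : IsBilin b) :
    IsBilin fun u v => a * b u v := by
  obtain ⟨B, hB⟩ := h
  exact ⟨a • B, fun u v => by simp [hB]⟩

lemma IsBilin.sum {ι : Type*} (s : Finset ι) {b : ι → E → E → ℝ} (h : ∀ i ∈ s, IsBilin (b i)) :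
    IsBilin fun u v => ∑ i ∈ s, b i u v := by
  classical
  induction s using Finset.induction_on with
  | empty => exact ⟨0, fun u v => by simp⟩
  | insert i s hi ih =>
    simp only [Finset.sum_insert hi]
    exact (h i (Finset.mem_insert_self i s)).add (ih fun j hj => h j (Finset.mem_insert_of_mem hj))

lemma IsBilin.mul {f g : E → ℝ} (hf : IsLinearMap ℝ f) (hg : IsLinearMap ℝ g) :
    IsBilin fun u v => f u * g v :=
  ⟨(LinearMap.mul ℝ ℝ).compl₁₂ (IsLinearMap.mk' f hf) (IsLinearMap.mk' g hg), fun u v => by simp⟩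

lemma IsBilin.swap {b : E → E → ℝ} (h : IsBilin b) : IsBilin fun u v => b v u := by
  obtain ⟨B, hB⟩ := h
  exact ⟨B.flip, fun u v => by simp [hB]⟩

/-- Pointwise bilinearity passes to the integral only together with integrability, since a
non-integrable function has integral zero by convention. -/
lemma IsBilin.setIntegral {X : Type*} [MeasurableSpace X] {μ : Measure X} {s : Set X}
    (hs : MeasurableSet s) {b : E → E → X → ℝ} (hb : ∀ x ∈ s, IsBilin fun u v => b u v x)
    (hi : ∀ u v, IntegrableOn (b u v) s μ) : IsBilin fun u v => ∫ x in s, b u v x ∂μ := by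
  refine ⟨LinearMap.mk₂ ℝ (fun u v => ∫ x in s, b u v x ∂μ) ?_ ?_ ?_ ?_, fun u v => rfl⟩
  · intro u u' v
    rw [← integral_add (hi u v) (hi u' v)]
    refine setIntegral_congr_fun hs fun x hx => ?_
    obtain ⟨B, hB⟩ := hb x hx
    simp only [hB, map_add, LinearMap.add_apply]
  · intro a u v
    rw [smul_eq_mul, ← integral_const_mul]
    refine setIntegral_congr_fun hs fun x hx => ?_
    obtain ⟨B, hB⟩ := hb x hx
    simp only [hB, map_smul, LinearMap.smul_apply, smul_eq_mul]
  · intro u v v'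
    rw [← integral_add (hi u v) (hi u v')]
    refine setIntegral_congr_fun hs fun x hx => ?_
    obtain ⟨B, hB⟩ := hb x hx
    simp only [hB, map_add]
  · intro a u v
    rw [smul_eq_mul, ← integral_const_mul]
    refine setIntegral_congr_fun hs fun x hx => ?_
    obtain ⟨B, hB⟩ := hb x hx
    simp only [hB, map_smul, smul_eq_mul]

lemma isLinearMap_sum {ι : Type*} (s : Finset ι) {f : ι → E → ℝ}
    (h : ∀ i ∈ s, IsLinearMap ℝ (f i)) : IsLinearMap ℝ fun u => ∑ i ∈ s, f i u :=
  ⟨fun u v => by rw [← Finset.sum_add_distrib]; exact Finset.sum_congr rfl fun i hi => (h i hi).1 u v,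
    fun a u => by rw [Finset.smul_sum]; exact Finset.sum_congr rfl fun i hi => (h i hi).2 a u⟩

end Bilinear

/-! ### Triangles, edges, arc length and normals. -/

section Region

lemma convex_region (t : Finset Plane) : Convex ℝ (region t) := convex_convexHull ℝ _

lemma isCompact_region (t : Finset Plane) : IsCompact (region t) :=
  t.finite_toSet.isCompact_convexHull ℝ

lemma measurableSet_region (t : Finset Plane) : MeasurableSet (region t) :=
  (isCompact_region t).measurableSet

lemma region_mono {e t : Finset Plane} (h : e ⊆ t) : region e ⊆ region t :=
  convexHull_mono (Finset.coe_subset.2 h)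

lemma exists_region_eq_segment {e : Finset Plane} (he : e.card = 2) :
    ∃ a b, a ≠ b ∧ a ∈ e ∧ b ∈ e ∧ region e = segment ℝ a b := by
  obtain ⟨a, b, hab, rfl⟩ := Finset.card_eq_two.1 he
  refine ⟨a, b, hab, by simp, by simp, ?_⟩
  rw [region, Finset.coe_pair, convexHull_pair]

lemma edgeLength_pos {e : Finset Plane} (he : e.card = 2) : 0 < Triangulation.edgeLength e := by
  obtain ⟨a, b, hab, ha, hb, -⟩ := exists_region_eq_segment he
  exact (dist_pos.2 hab).trans_le (Metric.dist_le_diam_of_mem (isCompact_region e).isBounded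
    (subset_convexHull ℝ _ ha) (subset_convexHull ℝ _ hb))

lemma hausdorffMeasure_region {e : Finset Plane} (he : e.card = 2) :
    μH[1] (region e) = ENNReal.ofReal (Triangulation.edgeLength e) := by
  obtain ⟨a, b, hab, ha, hb, h⟩ := exists_region_eq_segment he
  have : Metric.diam (segment ℝ a b) = dist a b := by
    rw [← convexHull_pair, convexHull_diam, Metric.diam_pair]
  rw [Triangulation.edgeLength, h, hausdorffMeasure_segment, this, edist_dist]

lemma integrableOn_edge {e : Finset Plane} (he : e.card = 2) {f : Plane → ℝ}
    (hf : ContinuousOn f (region e)) : IntegrableOn f (region e) μH[1] := by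
  obtain ⟨C, hC⟩ := (isCompact_region e).exists_bound_of_continuousOn hf
  exact IntegrableOn.of_bound (by rw [hausdorffMeasure_region he]; exact ENNReal.ofReal_lt_top)
    (hf.aestronglyMeasurable (measurableSet_region e)) C
    ((ae_restrict_iff' (measurableSet_region e)).2 (Filter.Eventually.of_forall hC))

/-- Guarantees that the choice made in `outerNormal` is a genuine unit normal. -/
lemma exists_isOuterNormal {t e : Finset Plane} (ht : t.card = 3) (he : e.card = 2) (h : e ⊆ t) :
    ∃ n, IsOuterNormal t e n := by
  classical
  obtain ⟨a, b, hab, rfl⟩ := Finset.card_eq_two.1 he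
  obtain ⟨c, hc⟩ : ∃ c, t \ {a, b} = {c} := Finset.card_eq_one.1 (by
    rw [Finset.card_sdiff_of_subset h, ht, he])
  have ht' : t = {a, b} ∪ {c} := by rw [← hc, Finset.union_sdiff_of_subset h]
  set d := b - a with hd
  have hd0 : d ≠ 0 := sub_ne_zero.2 hab.symm
  -- A quarter turn of the edge direction; its sign is then chosen by the position of the third
  -- vertex `c`.
  let n₀ : Plane := !₂[d 1, -d 0]
  have hperp : inner ℝ n₀ d = 0 := by
    simp [n₀, PiLp.inner_apply, Fin.sum_univ_two]
    ring
  have hn₀ : n₀ ≠ 0 := by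
    intro h0
    apply hd0
    ext i
    have h1 := congrArg (fun v : Plane => v 0) h0
    have h2 := congrArg (fun v : Plane => v 1) h0
    fin_cases i
    · simpa [n₀] using h2
    · simpa [n₀] using h1
  obtain ⟨m, hm0, hmd, hmc⟩ : ∃ m : Plane, m ≠ 0 ∧ inner ℝ m d = 0 ∧ inner ℝ m (c - a) ≤ 0 := by
    rcases le_total (inner ℝ n₀ (c - a)) 0 with h0 | h0
    · exact ⟨n₀, hn₀, hperp, h0⟩
    · exact ⟨-n₀, neg_ne_zero.2 hn₀, by rw [inner_neg_left, hperp, neg_zero],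
        by rw [inner_neg_left]; linarith⟩
  have hhalf : ∀ x ∈ region t, inner ℝ m (x - a) ≤ 0 := by
    have hcv : Convex ℝ {x : Plane | inner ℝ m x ≤ inner ℝ m a} :=
      convex_halfSpace_le (innerₛₗ ℝ m).isLinear _
    have hsub : (t : Set Plane) ⊆ {x : Plane | inner ℝ m x ≤ inner ℝ m a} := by
      intro x hx
      rw [inner_sub_right] at hmc
      rw [hd, inner_sub_right] at hmd
      rw [ht'] at hx
      simp only [Finset.coe_union, Finset.coe_insert, Finset.coe_singleton, mem_union, mem_insert_iff,
        mem_singleton_iff] at hx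
      change inner ℝ m x ≤ inner ℝ m a
      rcases hx with (rfl | rfl) | rfl <;> linarith
    intro x hx
    rw [inner_sub_right]
    exact sub_nonpos.2 (convexHull_min hsub hcv hx)
  have hm := norm_pos_iff.2 hm0
  refine ⟨‖m‖⁻¹ • m, by rw [norm_smul, norm_inv, norm_norm, inv_mul_cancel₀ hm.ne'], ?_⟩
  intro p hp x hx
  have hpa : inner ℝ m (x - p) = inner ℝ m (x - a) := by
    simp only [Finset.mem_insert, Finset.mem_singleton] at hp
    rcases hp with rfl | rfl
    · rfl
    · rw [hd, inner_sub_right] at hmd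
      rw [inner_sub_right, inner_sub_right]
      linarith
  rw [inner_smul_left, hpa]
  exact mul_nonpos_of_nonneg_of_nonpos (by simp) (hhalf x hx)

lemma norm_outerNormal {t e : Finset Plane} (ht : t.card = 3) (he : e.card = 2) (h : e ⊆ t) :
    ‖outerNormal t e‖ = 1 :=
  (Classical.epsilon_spec (exists_isOuterNormal ht he h)).1

end Region

/-! ### Bilinearity of the discrete forms on piecewise quadratics. -/

namespace Triangulation

variable {Ω : Set Plane} (T : Triangulation Ω)

/-- The Lagrange finite element space as a submodule. -/
def feSubmodule (k : ℕ) : Submodule ℝ C(closure Ω, ℝ) where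
  carrier := T.feSpace k
  add_mem' {u v} hu hv t ht := by
    obtain ⟨p, hp, h⟩ := hu t ht
    obtain ⟨q, hq, h'⟩ := hv t ht
    exact ⟨p + q, (MvPolynomial.totalDegree_add p q).trans (max_le hp hq), fun x hx => by
      simp [h x hx, h' x hx]⟩
  zero_mem' t _ := ⟨0, by simp, fun x _ => by simp⟩
  smul_mem' a u hu t ht := by
    obtain ⟨p, hp, h⟩ := hu t ht
    exact ⟨a • p, (MvPolynomial.totalDegree_smul_le a p).trans hp, fun x hx => by
      simp [h x hx, MvPolynomial.smul_eval]⟩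

lemma cst_mem_feSubmodule (k : ℕ) (c : ℝ) : cst c ∈ T.feSubmodule k := fun _ _ =>
  ⟨MvPolynomial.C c, by simp, fun x _ => by simp [cst]⟩

lemma V_subset_Z : T.V ⊆ T.Z := fun v hv t ht => by
  obtain ⟨p, hp, h⟩ := hv t ht
  exact ⟨p, hp.trans one_le_two, h⟩

variable {T} {t e : Finset Plane}

lemma region_subset (ht : t ∈ T.triangles) : region t ⊆ closure Ω := by
  rw [← T.cover]
  exact subset_iUnion₂_of_subset t ht subset_rfl

lemma exists_mem_region {x : Plane} (hx : x ∈ closure Ω) : ∃ t ∈ T.triangles, x ∈ region t := by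
  rw [← T.cover] at hx
  simpa [region] using hx

lemma isQuadOn_zeroExt {v : C(closure Ω, ℝ)} (hv : v ∈ T.feSubmodule 2) (ht : t ∈ T.triangles) :
    IsQuadOn (zeroExt v) (region t) := by
  obtain ⟨p, hp, h⟩ := hv t ht
  refine (isQuadOn_eval _ hp).congr fun x hx => ?_
  rw [zeroExt_of_mem v (region_subset ht hx)]
  exact h _ hx

lemma mem_adjacent : t ∈ T.adjacent e ↔ t ∈ T.triangles ∧ e ⊆ t := by
  classical
  simp [adjacent]

lemma mem_edges : e ∈ T.edges ↔ ∃ t ∈ T.triangles, e ⊆ t ∧ e.card = 2 := by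
  classical
  simp [edges, Finset.mem_powersetCard]

lemma card_of_mem_edges (he : e ∈ T.edges) : e.card = 2 := by
  obtain ⟨t, -, -, h⟩ := mem_edges.1 he
  exact h

lemma norm_outerNormal (he : e ∈ T.edges) (ht : t ∈ T.adjacent e) : ‖outerNormal t e‖ = 1 :=
  _root_.norm_outerNormal (T.card_eq t (mem_adjacent.1 ht).1) (card_of_mem_edges he)
    (mem_adjacent.1 ht).2

section ShapeRegular

variable {σ : ℝ} (hT : T.ShapeRegular σ)
include hT

lemma ShapeRegular.nonempty_interior (ht : t ∈ T.triangles) : (interior (region t)).Nonempty := by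
  obtain ⟨x, r, hr, h, -⟩ := hT t ht
  exact ⟨x, interior_mono h (Metric.ball_subset_interior_closedBall (Metric.mem_ball_self hr))⟩

/-- The inscribed disc supplies interior points, and a convex set with interior points has unique
one-sided derivatives. This makes `fderivWithin` linear in the function up to the edges. -/
lemma ShapeRegular.uniqueDiffOn (ht : t ∈ T.triangles) : UniqueDiffOn ℝ (region t) :=
  uniqueDiffOn_convex (convex_region t) (hT.nonempty_interior ht)

/-- Allows almost-everywhere identities between continuous functions to be extended to the whole
closed triangle. -/
lemma ShapeRegular.region_subset_closure_interior (ht : t ∈ T.triangles) :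
    region t ⊆ closure (interior (region t)) := by
  rw [(convex_region t).closure_interior_eq_closure_of_nonempty_interior (hT.nonempty_interior ht)]
  exact subset_closure

lemma ShapeRegular.isLinearMap_fderivWithin (ht : t ∈ T.triangles) {x : Plane} (hx : x ∈ region t) :
    IsLinearMap ℝ fun u : T.feSubmodule 2 =>
      fderivWithin ℝ (zeroExt (u : C(closure Ω, ℝ))) (region t) x := by
  have hU := hT.uniqueDiffOn ht
  have hd : ∀ u : T.feSubmodule 2, DifferentiableOn ℝ (zeroExt (u : C(closure Ω, ℝ))) (region t) :=
    fun u => (isQuadOn_zeroExt u.2 ht).differentiableOn hU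
  refine ⟨fun u v => ?_, fun a u => ?_⟩
  · rw [Submodule.coe_add, zeroExt_add]
    exact fderivWithin_add (hU x hx) (hd u x hx) (hd v x hx)
  · rw [Submodule.coe_smul, zeroExt_smul]
    exact fderivWithin_const_smul (hU x hx) (hd u x hx) a

lemma ShapeRegular.isLinearMap_hess (ht : t ∈ T.triangles) {x : Plane} (hx : x ∈ region t) :
    IsLinearMap ℝ fun u : T.feSubmodule 2 => hess t (zeroExt (u : C(closure Ω, ℝ))) x := by
  have hU := hT.uniqueDiffOn ht
  have hd : ∀ u : T.feSubmodule 2,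
      DifferentiableOn ℝ (fderivWithin ℝ (zeroExt (u : C(closure Ω, ℝ))) (region t)) (region t) :=
    fun u => (isQuadOn_zeroExt u.2 ht).differentiableOn_fderivWithin hU
  refine ⟨fun u v => ?_, fun a u => ?_⟩
  · have h : ∀ y ∈ region t, fderivWithin ℝ (zeroExt ((u + v : T.feSubmodule 2) : C(closure Ω, ℝ)))
        (region t) y = (fderivWithin ℝ (zeroExt (u : C(closure Ω, ℝ))) (region t)
          + fderivWithin ℝ (zeroExt (v : C(closure Ω, ℝ))) (region t)) y :=
      fun y hy => (hT.isLinearMap_fderivWithin ht hy).1 u v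
    rw [hess, fderivWithin_congr h (h x hx)]
    exact fderivWithin_add (hU x hx) (hd u x hx) (hd v x hx)
  · have h : ∀ y ∈ region t, fderivWithin ℝ (zeroExt ((a • u : T.feSubmodule 2) : C(closure Ω, ℝ)))
        (region t) y = (a • fderivWithin ℝ (zeroExt (u : C(closure Ω, ℝ))) (region t)) y :=
      fun y hy => (hT.isLinearMap_fderivWithin ht hy).2 a u
    rw [hess, fderivWithin_congr h (h x hx)]
    exact fderivWithin_const_smul (hU x hx) (hd u x hx) a

lemma ShapeRegular.isLinearMap_hess_apply (ht : t ∈ T.triangles) {x : Plane} (hx : x ∈ region t)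
    (y z : Plane) :
    IsLinearMap ℝ fun u : T.feSubmodule 2 => hess t (zeroExt (u : C(closure Ω, ℝ))) x y z := by
  have h := hT.isLinearMap_hess ht hx
  exact ⟨fun u v => by simp only [h.1]; simp, fun a u => by simp only [h.2]; simp⟩

lemma ShapeRegular.isLinearMap_inner_grad (ht : t ∈ T.triangles) {x : Plane} (hx : x ∈ region t)
    (y : Plane) : IsLinearMap ℝ fun u : T.feSubmodule 2 =>
      inner ℝ y (grad t (zeroExt (u : C(closure Ω, ℝ))) x) := by
  have h := hT.isLinearMap_fderivWithin ht hx
  simp only [grad, gradientWithin]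
  exact ⟨fun u v => by rw [h.1, map_add, inner_add_right],
    fun a u => by rw [h.2, map_smulₛₗ, inner_smul_right]; simp⟩

lemma ShapeRegular.continuousOn_grad (ht : t ∈ T.triangles) (u : T.feSubmodule 2) :
    ContinuousOn (grad t (zeroExt (u : C(closure Ω, ℝ)))) (region t) :=
  (InnerProductSpace.toDual ℝ Plane).symm.continuous.comp_continuousOn
    ((isQuadOn_zeroExt u.2 ht).continuousOn_fderivWithin (hT.uniqueDiffOn ht))

lemma ShapeRegular.exists_hess_eq (ht : t ∈ T.triangles) (u : T.feSubmodule 2) :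
    ∃ D, ∀ x ∈ region t, hess t (zeroExt (u : C(closure Ω, ℝ))) x = D := by
  obtain ⟨A, D, h⟩ := (isQuadOn_zeroExt u.2 ht).exists_fderivWithin (hT.uniqueDiffOn ht)
  exact ⟨D, fun x hx => (h x hx).2.2⟩

lemma ShapeRegular.continuousOn_hess_apply (ht : t ∈ T.triangles) (u : T.feSubmodule 2)
    (y z : Plane) : ContinuousOn (fun x => hess t (zeroExt (u : C(closure Ω, ℝ))) x y z)
      (region t) := by
  obtain ⟨D, hD⟩ := hT.exists_hess_eq ht u
  exact (continuousOn_const (c := D y z)).congr fun x hx => by rw [hD x hx]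

lemma ShapeRegular.continuousOn_hessProd (ht : t ∈ T.triangles) (u v : T.feSubmodule 2) :
    ContinuousOn (hessProd t (zeroExt (u : C(closure Ω, ℝ))) (zeroExt (v : C(closure Ω, ℝ))))
      (region t) :=
  continuousOn_finsetSum _ fun _ _ => continuousOn_finsetSum _ fun _ _ =>
    (hT.continuousOn_hess_apply ht u _ _).mul (hT.continuousOn_hess_apply ht v _ _)

lemma ShapeRegular.continuousOn_jump (u : T.feSubmodule 2) :
    ContinuousOn (T.jump e (zeroExt (u : C(closure Ω, ℝ)))) (region e) :=
  (continuousOn_finsetSum _ fun _ ht => continuousOn_const.inner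
    ((hT.continuousOn_grad (mem_adjacent.1 ht).1 u).mono (region_mono (mem_adjacent.1 ht).2))).neg

lemma ShapeRegular.continuousOn_avg (u : T.feSubmodule 2) :
    ContinuousOn (T.avg e (zeroExt (u : C(closure Ω, ℝ)))) (region e) :=
  continuousOn_const.mul (continuousOn_finsetSum _ fun _ ht =>
    (hT.continuousOn_hess_apply (mem_adjacent.1 ht).1 u _ _).mono
      (region_mono (mem_adjacent.1 ht).2))

lemma ShapeRegular.isLinearMap_jump {x : Plane} (hx : x ∈ region e) :
    IsLinearMap ℝ fun u : T.feSubmodule 2 => T.jump e (zeroExt (u : C(closure Ω, ℝ))) x := by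
  have h := isLinearMap_sum (T.adjacent e) fun t ht => hT.isLinearMap_inner_grad
    (mem_adjacent.1 ht).1 (region_mono (mem_adjacent.1 ht).2 hx) (outerNormal t e)
  exact ⟨fun u v => by simp only [jump, h.1]; ring,
    fun a u => by simp only [jump, h.2, smul_eq_mul]; ring⟩

lemma ShapeRegular.isLinearMap_avg {x : Plane} (hx : x ∈ region e) :
    IsLinearMap ℝ fun u : T.feSubmodule 2 => T.avg e (zeroExt (u : C(closure Ω, ℝ))) x := by
  have h := isLinearMap_sum (T.adjacent e) fun t ht => hT.isLinearMap_hess_apply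
    (mem_adjacent.1 ht).1 (region_mono (mem_adjacent.1 ht).2 hx) (outerNormal t e) (outerNormal t e)
  exact ⟨fun u v => by simp only [avg, h.1]; ring,
    fun a u => by simp only [avg, h.2, smul_eq_mul]; ring⟩

lemma ShapeRegular.isBilin_gradIP : IsBilin fun u v : T.feSubmodule 2 => T.gradIP u v := by
  refine IsBilin.sum _ fun t ht => IsBilin.setIntegral (measurableSet_region t) (fun x hx => ?_)
    fun u v => ((hT.continuousOn_grad ht u).inner (hT.continuousOn_grad ht v)).integrableOn_compact
      (isCompact_region t)
  have h := fun i => hT.isLinearMap_inner_grad ht hx (EuclideanSpace.single i 1)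
  have := IsBilin.sum Finset.univ fun i _ => IsBilin.mul (h i) (h i)
  convert this using 3 with u v
  simp [PiLp.inner_apply, mul_comm]

lemma ShapeRegular.isBilin_hess : IsBilin fun u v : T.feSubmodule 2 =>
    ∑ t ∈ T.triangles, ∫ x in region t, hessProd t (zeroExt (u : C(closure Ω, ℝ)))
      (zeroExt (v : C(closure Ω, ℝ))) x :=
  IsBilin.sum _ fun t ht => IsBilin.setIntegral (measurableSet_region t)
    (fun _ hx => IsBilin.sum _ fun _ _ => IsBilin.sum _ fun _ _ =>
      IsBilin.mul (hT.isLinearMap_hess_apply ht hx _ _) (hT.isLinearMap_hess_apply ht hx _ _))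
    fun u v => (hT.continuousOn_hessProd ht u v).integrableOn_compact (isCompact_region t)

lemma ShapeRegular.isBilin_aIP (α : ℝ) : IsBilin fun u v : T.feSubmodule 2 => T.aIP α u v := by
  have h1 : IsBilin fun u v : T.feSubmodule 2 => ∑ e ∈ T.edges, edgeIntegral e fun x =>
      T.avg e (zeroExt (u : C(closure Ω, ℝ))) x * T.jump e (zeroExt (v : C(closure Ω, ℝ))) x :=
    IsBilin.sum _ fun e he => IsBilin.setIntegral (measurableSet_region e)
      (fun _ hx => IsBilin.mul (hT.isLinearMap_avg hx) (hT.isLinearMap_jump hx))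
      fun u v => integrableOn_edge (card_of_mem_edges he)
        ((hT.continuousOn_avg u).mul (hT.continuousOn_jump v))
  have h2 : IsBilin fun u v : T.feSubmodule 2 => ∑ e ∈ T.edges, (edgeLength e)⁻¹ *
      edgeIntegral e fun x =>
        T.jump e (zeroExt (u : C(closure Ω, ℝ))) x * T.jump e (zeroExt (v : C(closure Ω, ℝ))) x :=
    IsBilin.sum _ fun e he => IsBilin.const_mul _ <| IsBilin.setIntegral (measurableSet_region e)
      (fun _ hx => IsBilin.mul (hT.isLinearMap_jump hx) (hT.isLinearMap_jump hx))
      fun u v => integrableOn_edge (card_of_mem_edges he)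
        ((hT.continuousOn_jump u).mul (hT.continuousOn_jump v))
  exact ((hT.isBilin_hess.add h1).add h1.swap).add (h2.const_mul α)

end ShapeRegular

lemma gradIP_comm (u v : C(closure Ω, ℝ)) : T.gradIP u v = T.gradIP v u := by
  simp only [gradIP, real_inner_comm]

lemma aIP_comm (α : ℝ) (u v : C(closure Ω, ℝ)) : T.aIP α u v = T.aIP α v u := by
  have h1 : ∀ t x, hessProd t (zeroExt u) (zeroExt v) x = hessProd t (zeroExt v) (zeroExt u) x :=
    fun t x => Finset.sum_congr rfl fun _ _ => Finset.sum_congr rfl fun _ _ => mul_comm _ _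
  have h2 : ∀ e x, T.jump e (zeroExt u) x * T.jump e (zeroExt v) x
      = T.jump e (zeroExt v) x * T.jump e (zeroExt u) x := fun e x => mul_comm _ _
  simp only [aIP, h1, h2]
  ring

end Triangulation

/-! ### Discrete trace inequality, coercivity of the penalty form and kernel of the gradient form.
-/

/-- Cauchy-Schwarz over the four index pairs, the matrix `(nᵢ nⱼ)` having Frobenius norm `‖n‖² = 1`.
-/
lemma sq_apply_apply_le_frobenius (D : Plane →L[ℝ] Plane →L[ℝ] ℝ) {n : Plane} (hn : ‖n‖ = 1) :
    D n n ^ 2 ≤ ∑ i : Fin 2, ∑ j : Fin 2, D (EuclideanSpace.single i 1) (EuclideanSpace.single j 1) *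
      D (EuclideanSpace.single i 1) (EuclideanSpace.single j 1) := by
  have hexp : n = n 0 • EuclideanSpace.single 0 1 + n 1 • EuclideanSpace.single 1 1 := by
    ext i
    fin_cases i <;> simp
  have hn1 : n 0 ^ 2 + n 1 ^ 2 = 1 := by
    have := EuclideanSpace.norm_sq_eq n
    rw [hn] at this
    simpa [Fin.sum_univ_two] using this.symm
  have hD : D n n = ∑ k : Fin 2 × Fin 2, (n k.1 * n k.2) *
      D (EuclideanSpace.single k.1 1) (EuclideanSpace.single k.2 1) := by
    conv_lhs => rw [hexp]
    simp only [map_add, map_smul, _root_.add_apply, _root_.smul_apply,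
      smul_eq_mul, Fintype.sum_prod_type, Fin.sum_univ_two]
    ring
  have hone : ∑ k : Fin 2 × Fin 2, (n k.1 * n k.2) ^ 2 = 1 := by
    simp only [Fintype.sum_prod_type, Fin.sum_univ_two]
    linear_combination (n 0 ^ 2 + n 1 ^ 2 + 1) * hn1
  rw [hD]
  refine (Finset.sum_mul_sq_le_sq_mul_sq _ _ _).trans ?_
  rw [hone, one_mul, Fintype.sum_prod_type]
  simp only [pow_two, le_refl]

lemma sq_average_le {ι : Type*} (s : Finset ι) (f : ι → ℝ) :
    ((s.card : ℝ)⁻¹ * ∑ i ∈ s, f i) ^ 2 ≤ ∑ i ∈ s, f i ^ 2 := by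
  rcases s.eq_empty_or_nonempty with rfl | hs
  · simp
  have hc : (1 : ℝ) ≤ s.card := by exact_mod_cast hs.card_pos
  have h0 : 0 ≤ ∑ i ∈ s, f i ^ 2 := Finset.sum_nonneg fun _ _ => sq_nonneg _
  rw [mul_pow, inv_pow, inv_mul_le_iff₀ (by positivity)]
  refine (sq_sum_le_card_mul_sum_sq).trans ?_
  gcongr
  nlinarith

namespace Triangulation

variable {Ω : Set Plane} {T : Triangulation Ω} {t e : Finset Plane}

lemma hessProd_self_nonneg (t : Finset Plane) (v : Plane → ℝ) (x : Plane) : 0 ≤ hessProd t v v x :=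
  Finset.sum_nonneg fun _ _ => Finset.sum_nonneg fun _ _ => mul_self_nonneg _

lemma sq_avg_le (he : e ∈ T.edges) (v : Plane → ℝ) (x : Plane) :
    T.avg e v x ^ 2 ≤ ∑ t ∈ T.adjacent e, hessProd t v v x :=
  (sq_average_le _ _).trans (Finset.sum_le_sum fun _ ht =>
    sq_apply_apply_le_frobenius _ (norm_outerNormal he ht))

/-- Double counting: a triangle has at most three edges in the mesh. -/
lemma sum_edges_sum_adjacent_le {X : Finset Plane → ℝ} (hX : ∀ t, 0 ≤ X t) :
    ∑ e ∈ T.edges, ∑ t ∈ T.adjacent e, X t ≤ 3 * ∑ t ∈ T.triangles, X t := by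
  classical
  rw [Finset.sum_comm' (t' := T.triangles) (s' := fun t => T.edges.filter (· ⊆ t))
    (by intro e t; simp only [mem_adjacent, Finset.mem_filter]; tauto), Finset.mul_sum]
  refine Finset.sum_le_sum fun t ht => ?_
  rw [Finset.sum_const, nsmul_eq_mul]
  refine mul_le_mul_of_nonneg_right ?_ (hX t)
  have h1 : T.edges.filter (· ⊆ t) ⊆ t.powersetCard 2 := by
    intro e he
    rw [Finset.mem_filter] at he
    exact Finset.mem_powersetCard.2 ⟨he.2, card_of_mem_edges he.1⟩
  have h2 := Finset.card_le_card h1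
  rw [Finset.card_powersetCard, T.card_eq t ht] at h2
  exact_mod_cast h2

section ShapeRegular

variable {σ : ℝ} (hT : T.ShapeRegular σ)
include hT

/-- An edge is no longer than the diameter, which is at most `2σr` for the inscribed disc of radius
`r`, while the area is at least `π r² ≥ r²`. -/
lemma ShapeRegular.sq_edgeLength_le (ht : t ∈ T.triangles) (h : e ⊆ t) :
    edgeLength e ^ 2 ≤ 4 * σ ^ 2 * volume.real (region t) := by
  obtain ⟨x, r, hr, hball, hd⟩ := hT t ht
  have h1 : edgeLength e ≤ σ * (2 * r) :=
    (Metric.diam_mono (region_mono h) (isCompact_region t).isBounded).trans hd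
  have h2 : r ^ 2 ≤ volume.real (region t) := by
    have hm : volume.real (Metric.closedBall x r) ≤ volume.real (region t) :=
      measureReal_mono hball (isCompact_region t).measure_lt_top.ne
    have hv : volume.real (Metric.closedBall x r) = r ^ 2 * Real.pi := by
      rw [measureReal_def, EuclideanSpace.volume_closedBall_fin_two, ENNReal.toReal_mul,
        ENNReal.toReal_pow, ENNReal.toReal_ofReal hr.le, ENNReal.toReal_ofReal Real.pi_pos.le]
    rw [hv] at hm
    nlinarith [Real.pi_gt_three, sq_nonneg r]
  have h0 : 0 ≤ edgeLength e := Metric.diam_nonneg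
  calc edgeLength e ^ 2 ≤ (σ * (2 * r)) ^ 2 := by gcongr
    _ = 4 * σ ^ 2 * r ^ 2 := by ring
    _ ≤ _ := by gcongr

lemma ShapeRegular.integral_hessProd (ht : t ∈ T.triangles) (u : T.feSubmodule 2) {y : Plane}
    (hy : y ∈ region t) :
    ∫ x in region t, hessProd t (zeroExt (u : C(closure Ω, ℝ))) (zeroExt (u : C(closure Ω, ℝ))) x
      = volume.real (region t) *
        hessProd t (zeroExt (u : C(closure Ω, ℝ))) (zeroExt (u : C(closure Ω, ℝ))) y := by
  obtain ⟨D, hD⟩ := hT.exists_hess_eq ht u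
  rw [setIntegral_congr_fun (measurableSet_region t) (g := fun _ =>
    hessProd t (zeroExt (u : C(closure Ω, ℝ))) (zeroExt (u : C(closure Ω, ℝ))) y)]
  · simp
  · intro x hx
    simp only [hessProd, hD x hx, hD y hy]

/-- Discrete trace inequality for the averages of the second normal derivatives. -/
lemma ShapeRegular.edgeLength_mul_integral_sq_avg_le (he : e ∈ T.edges) (u : T.feSubmodule 2) :
    edgeLength e * edgeIntegral e (fun x => T.avg e (zeroExt (u : C(closure Ω, ℝ))) x ^ 2) ≤
      ∑ t ∈ T.adjacent e, 4 * σ ^ 2 * ∫ x in region t,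
        hessProd t (zeroExt (u : C(closure Ω, ℝ))) (zeroExt (u : C(closure Ω, ℝ))) x := by
  set S := ∑ t ∈ T.adjacent e, 4 * σ ^ 2 * ∫ x in region t,
    hessProd t (zeroExt (u : C(closure Ω, ℝ))) (zeroExt (u : C(closure Ω, ℝ))) x with hS
  have hl := edgeLength_pos (card_of_mem_edges he)
  have hpt : ∀ x ∈ region e, T.avg e (zeroExt (u : C(closure Ω, ℝ))) x ^ 2 ≤
      S / edgeLength e ^ 2 := by
    intro x hx
    refine (sq_avg_le he _ x).trans ?_
    rw [le_div_iff₀ (by positivity), Finset.sum_mul]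
    refine Finset.sum_le_sum fun t ht => ?_
    obtain ⟨ht, h⟩ := mem_adjacent.1 ht
    -- The Hessian is constant, so its value on the edge is its integral over the triangle divided
    -- by the area.
    rw [hT.integral_hessProd ht u (region_mono h hx), mul_comm, ← mul_assoc]
    exact mul_le_mul_of_nonneg_right (hT.sq_edgeLength_le ht h) (hessProd_self_nonneg _ _ _)
  have hint : edgeIntegral e (fun x => T.avg e (zeroExt (u : C(closure Ω, ℝ))) x ^ 2) ≤
      ∫ _ in region e, S / edgeLength e ^ 2 ∂μH[1] :=
    setIntegral_mono_on (integrableOn_edge (card_of_mem_edges he) ((hT.continuousOn_avg u).pow 2))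
      (integrableOn_edge (card_of_mem_edges he) continuousOn_const) (measurableSet_region e) hpt
  rw [setIntegral_const, measureReal_def, hausdorffMeasure_region (card_of_mem_edges he),
    ENNReal.toReal_ofReal hl.le, smul_eq_mul] at hint
  calc _ ≤ edgeLength e * (edgeLength e * (S / edgeLength e ^ 2)) := by gcongr
    _ = S := by field_simp

/-- Young's inequality with weight `K`, scaled by the edge length so that both sides match the trace
inequality and the penalty term. -/
lemma ShapeRegular.neg_le_two_mul_integral_avg_mul_jump (he : e ∈ T.edges) (u : T.feSubmodule 2)
    {K : ℝ} (hK : 0 < K) :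
    -(K⁻¹ * (edgeLength e * edgeIntegral e (fun x => T.avg e (zeroExt (u : C(closure Ω, ℝ))) x ^ 2))
      + K * ((edgeLength e)⁻¹ *
        edgeIntegral e (fun x => T.jump e (zeroExt (u : C(closure Ω, ℝ))) x ^ 2))) ≤
      2 * edgeIntegral e (fun x => T.avg e (zeroExt (u : C(closure Ω, ℝ))) x *
        T.jump e (zeroExt (u : C(closure Ω, ℝ))) x) := by
  have hl := edgeLength_pos (card_of_mem_edges he)
  have hca := hT.continuousOn_avg (e := e) u
  have hcj := hT.continuousOn_jump (e := e) u
  simp only [edgeIntegral]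
  rw [← mul_assoc, ← mul_assoc, ← integral_const_mul, ← integral_const_mul, ← integral_const_mul,
    ← integral_add, ← integral_neg]
  · refine setIntegral_mono_on (integrableOn_edge (card_of_mem_edges he) (by fun_prop))
      (integrableOn_edge (card_of_mem_edges he) (by fun_prop)) (measurableSet_region e) fun x _ => ?_
    set a := T.avg e (zeroExt (u : C(closure Ω, ℝ))) x
    set j := T.jump e (zeroExt (u : C(closure Ω, ℝ))) x
    rw [neg_le_iff_add_nonneg]
    have : 2 * (a * j) + (K⁻¹ * edgeLength e * a ^ 2 + K * (edgeLength e)⁻¹ * j ^ 2)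
        = K⁻¹ * (edgeLength e)⁻¹ * (edgeLength e * a + K * j) ^ 2 := by
      field_simp
      ring
    rw [this]
    positivity
  · exact integrableOn_edge (card_of_mem_edges he) (by fun_prop)
  · exact integrableOn_edge (card_of_mem_edges he) (by fun_prop)

/-- Coercivity of the interior penalty form for sufficiently large penalty parameters. -/
theorem ShapeRegular.half_norm2hSq_le_aIP {α : ℝ} (hα : 2 * (24 * σ ^ 2 + 1) ≤ α)
    (u : T.feSubmodule 2) : 1 / 2 * T.norm2hSq α u ≤ T.aIP α u u := by
  -- The trace inequality gives `4σ²` per adjacent triangle, hence `12σ²` after summing over edges.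
  -- This `K` makes `12σ² / K ≤ 1/2`, and `α ≥ 2K` makes the Young term in the jumps at most half of
  -- the penalty.
  set K := 24 * σ ^ 2 + 1 with hK
  have hK0 : 0 < K := by positivity
  set H := ∑ t ∈ T.triangles, ∫ x in region t,
    hessProd t (zeroExt (u : C(closure Ω, ℝ))) (zeroExt (u : C(closure Ω, ℝ))) x with hH
  set J := ∑ e ∈ T.edges, (edgeLength e)⁻¹ *
    edgeIntegral e (fun x => T.jump e (zeroExt (u : C(closure Ω, ℝ))) x ^ 2) with hJ
  set A := ∑ e ∈ T.edges, edgeIntegral e (fun x => T.avg e (zeroExt (u : C(closure Ω, ℝ))) x *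
    T.jump e (zeroExt (u : C(closure Ω, ℝ))) x) with hA
  have hi0 : ∀ t, 0 ≤ ∫ x in region t,
      hessProd t (zeroExt (u : C(closure Ω, ℝ))) (zeroExt (u : C(closure Ω, ℝ))) x :=
    fun t => integral_nonneg fun x => hessProd_self_nonneg _ _ _
  have hH0 : 0 ≤ H := Finset.sum_nonneg fun t _ => hi0 t
  have hJ0 : 0 ≤ J := Finset.sum_nonneg fun e he =>
    mul_nonneg (inv_nonneg.2 Metric.diam_nonneg) (integral_nonneg fun x => sq_nonneg _)
  have hnorm : T.norm2hSq α u = H + α * J := by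
    rw [norm2hSq, hJ, Finset.mul_sum]
    simp only [div_eq_mul_inv, mul_assoc]
    rfl
  have ha : T.aIP α u u = H + 2 * A + α * J := by
    simp only [aIP, ← pow_two]
    ring
  have hA' : -(K⁻¹ * (12 * σ ^ 2 * H) + K * J) ≤ 2 * A := by
    have h2A : 2 * A = ∑ e ∈ T.edges, 2 * edgeIntegral e (fun x =>
        T.avg e (zeroExt (u : C(closure Ω, ℝ))) x * T.jump e (zeroExt (u : C(closure Ω, ℝ))) x) :=
      Finset.mul_sum _ _ _
    rw [h2A]
    refine le_trans ?_ (Finset.sum_le_sum fun e he =>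
      hT.neg_le_two_mul_integral_avg_mul_jump he u hK0)
    rw [Finset.sum_neg_distrib, Finset.sum_add_distrib, ← Finset.mul_sum, ← Finset.mul_sum, ← hJ]
    refine neg_le_neg (add_le_add_left (mul_le_mul_of_nonneg_left ?_ (inv_nonneg.2 hK0.le)) _)
    refine (Finset.sum_le_sum fun e he => hT.edgeLength_mul_integral_sq_avg_le he u).trans ?_
    refine (sum_edges_sum_adjacent_le fun t => mul_nonneg (by positivity) (hi0 t)).trans ?_
    rw [← Finset.mul_sum, ← hH]
    exact le_of_eq (by ring)
  have hK1 : K⁻¹ * (12 * σ ^ 2 * H) ≤ 1 / 2 * H := by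
    rw [inv_mul_le_iff₀ hK0, hK]
    nlinarith [sq_nonneg σ]
  have hK2 : K * J ≤ 1 / 2 * α * J := by
    gcongr
    linarith
  rw [hnorm, ha]
  linarith

/-- The gradient vanishes on every triangle, so the function takes at most one value per triangle,
finitely many in all. A continuous real function with finitely many values on a connected set is
constant. -/
lemma ShapeRegular.exists_eq_cst_of_gradIP_self (hc : IsConnected Ω) (u : T.feSubmodule 2)
    (hu : T.gradIP u u = 0) : ∃ c, (u : C(closure Ω, ℝ)) = cst c := by
  have hg : ∀ t ∈ T.triangles, ∀ x ∈ region t, grad t (zeroExt (u : C(closure Ω, ℝ))) x = 0 := by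
    intro t ht
    have h0 : ∀ t, 0 ≤ ∫ x in region t, (inner ℝ (grad t (zeroExt (u : C(closure Ω, ℝ))) x)
        (grad t (zeroExt (u : C(closure Ω, ℝ))) x) : ℝ) :=
      fun t => integral_nonneg fun x => real_inner_self_nonneg
    have h1 := (Finset.sum_eq_zero_iff_of_nonneg fun t _ => h0 t).1 hu t ht
    have hcont := (hT.continuousOn_grad ht u).inner (𝕜 := ℝ) (hT.continuousOn_grad ht u)
    have h2 := (setIntegral_eq_zero_iff_of_nonneg_ae
      (Filter.Eventually.of_forall fun x => real_inner_self_nonneg)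
      (hcont.integrableOn_compact (isCompact_region t))).1 h1
    have h3 := eqOn_of_ae_eq h2 hcont continuousOn_const (hT.region_subset_closure_interior ht)
    exact fun x hx => inner_self_eq_zero.1 (h3 hx)
  have hconst : ∀ t ∈ T.triangles, ∀ x ∈ region t, ∀ y ∈ region t,
      zeroExt (u : C(closure Ω, ℝ)) x = zeroExt (u : C(closure Ω, ℝ)) y := by
    intro t ht x hx y hy
    refine (convex_region t).is_const_of_fderivWithin_eq_zero (𝕜 := ℝ)
      ((isQuadOn_zeroExt u.2 ht).differentiableOn (hT.uniqueDiffOn ht)) (fun z hz => ?_) hx hy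
    have := hg t ht z hz
    rwa [grad, gradientWithin, LinearIsometryEquiv.map_eq_zero_iff] at this
  have hpre : IsPreconnected (zeroExt (u : C(closure Ω, ℝ)) '' closure Ω) :=
    hc.isPreconnected.closure.image _ (continuousOn_zeroExt _)
  have hfin : (zeroExt (u : C(closure Ω, ℝ)) '' closure Ω).Finite := by
    have hsub : zeroExt (u : C(closure Ω, ℝ)) '' closure Ω ⊆
        ⋃ t ∈ T.triangles, zeroExt (u : C(closure Ω, ℝ)) '' region t := by
      rintro _ ⟨x, hx, rfl⟩
      obtain ⟨t, ht, hxt⟩ := exists_mem_region (T := T) hx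
      exact mem_iUnion₂.2 ⟨t, ht, mem_image_of_mem _ hxt⟩
    refine (T.triangles.finite_toSet.biUnion fun t ht => Set.Subsingleton.finite ?_).subset hsub
    rintro _ ⟨x, hx, rfl⟩ _ ⟨y, hy, rfl⟩
    exact hconst t ht x hx y hy
  -- A connected set of reals with two points would be infinite.
  have hsing : (zeroExt (u : C(closure Ω, ℝ)) '' closure Ω).Subsingleton := by
    rw [← Set.not_nontrivial_iff]
    exact fun hnt => hpre.infinite_of_nontrivial hnt hfin
  obtain ⟨x₀, hx₀⟩ := hc.nonempty.closure
  refine ⟨zeroExt (u : C(closure Ω, ℝ)) x₀, ?_⟩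
  ext x
  rw [← zeroExt_coe]
  exact hsing (mem_image_of_mem _ x.2) (mem_image_of_mem _ hx₀)

end ShapeRegular

/-! ### Constants lie in the kernel of both forms. -/

lemma fderivWithin_cst (ht : t ∈ T.triangles) (c : ℝ) {x : Plane}
    (hx : x ∈ region t) :
    fderivWithin ℝ (zeroExt (cst c : C(closure Ω, ℝ))) (region t) x = 0 := by
  have h : ∀ y ∈ region t, zeroExt (cst c : C(closure Ω, ℝ)) y = c := fun y hy =>
    zeroExt_of_mem _ (region_subset ht hy)
  rw [fderivWithin_congr h (h x hx)]
  simp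

lemma grad_cst (ht : t ∈ T.triangles) (c : ℝ) {x : Plane} (hx : x ∈ region t) :
    grad t (zeroExt (cst c : C(closure Ω, ℝ))) x = 0 := by
  rw [grad, gradientWithin, fderivWithin_cst ht c hx, map_zero]

lemma hess_cst (ht : t ∈ T.triangles) (c : ℝ) {x : Plane} (hx : x ∈ region t) :
    hess t (zeroExt (cst c : C(closure Ω, ℝ))) x = 0 := by
  rw [hess, fderivWithin_congr (f := fun _ => 0)
    (fun y hy => fderivWithin_cst ht c hy) (fderivWithin_cst ht c hx)]
  simp

lemma gradIP_cst (c : ℝ) (v : C(closure Ω, ℝ)) : T.gradIP (cst c) v = 0 :=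
  Finset.sum_eq_zero fun t ht => setIntegral_eq_zero_of_forall_eq_zero fun x hx => by
    rw [grad_cst ht c hx, inner_zero_left]

lemma aIP_cst (α c : ℝ) (v : C(closure Ω, ℝ)) : T.aIP α (cst c) v = 0 := by
  have hj : ∀ e, ∀ x ∈ region e, T.jump e (zeroExt (cst c : C(closure Ω, ℝ))) x = 0 := by
    intro e x hx
    rw [jump, neg_eq_zero]
    refine Finset.sum_eq_zero fun t ht => ?_
    obtain ⟨ht, h⟩ := mem_adjacent.1 ht
    rw [grad_cst ht c (region_mono h hx), inner_zero_right]
  have ha : ∀ e, ∀ x ∈ region e, T.avg e (zeroExt (cst c : C(closure Ω, ℝ))) x = 0 := by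
    intro e x hx
    rw [avg, Finset.sum_eq_zero, mul_zero]
    intro t ht
    obtain ⟨ht, h⟩ := mem_adjacent.1 ht
    rw [hess_cst ht c (region_mono h hx)]
    rfl
  have h1 : ∑ t ∈ T.triangles, ∫ x in region t,
      hessProd t (zeroExt (cst c : C(closure Ω, ℝ))) (zeroExt v) x = 0 :=
    Finset.sum_eq_zero fun t ht => setIntegral_eq_zero_of_forall_eq_zero fun x hx => by
      simp [hessProd, hess_cst ht c hx]
  have h2 : ∑ e ∈ T.edges, edgeIntegral e (fun x =>
      T.avg e (zeroExt (cst c : C(closure Ω, ℝ))) x * T.jump e (zeroExt v) x) = 0 :=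
    Finset.sum_eq_zero fun e _ => setIntegral_eq_zero_of_forall_eq_zero fun x hx => by
      rw [ha e x hx, zero_mul]
  have h3 : ∑ e ∈ T.edges, edgeIntegral e (fun x =>
      T.avg e (zeroExt v) x * T.jump e (zeroExt (cst c : C(closure Ω, ℝ))) x) = 0 :=
    Finset.sum_eq_zero fun e _ => setIntegral_eq_zero_of_forall_eq_zero fun x hx => by
      rw [hj e x hx, mul_zero]
  have h4 : ∑ e ∈ T.edges, (edgeLength e)⁻¹ * edgeIntegral e (fun x =>
      T.jump e (zeroExt (cst c : C(closure Ω, ℝ))) x * T.jump e (zeroExt v) x) = 0 :=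
    Finset.sum_eq_zero fun e _ => by
      rw [edgeIntegral, setIntegral_eq_zero_of_forall_eq_zero, mul_zero]
      intro x hx
      rw [hj e x hx, zero_mul]
  rw [aIP, h1, h2, h3, h4]
  simp

end Triangulation

section Bilinear

variable {E : Type*} [AddCommGroup E] [Module ℝ E] {b : E → E → ℝ}

lemma IsBilin.add_left (h : IsBilin b) (u u' v : E) : b (u + u') v = b u v + b u' v := by
  obtain ⟨B, hB⟩ := h
  simp [hB]

lemma IsBilin.smul_left (h : IsBilin b) (a : ℝ) (u v : E) : b (a • u) v = a * b u v := by
  obtain ⟨B, hB⟩ := h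
  simp [hB]

lemma IsBilin.comp {F : Type*} [AddCommGroup F] [Module ℝ F] (h : IsBilin b) (f : F →ₗ[ℝ] E) :
    IsBilin fun u v => b (f u) (f v) := by
  obtain ⟨B, hB⟩ := h
  exact ⟨B.compl₁₂ f f, fun u v => by simp [hB]⟩

end Bilinear

/-! ### Finite dimension and the discrete inverse Laplacian. -/

namespace Triangulation

variable {Ω : Set Plane} {T : Triangulation Ω}

/-- A function is determined by its restrictions to the triangles, which cover the closure of `Ω`,
and these lie in the image `LinearMap.range Φ` of a finite-dimensional space of coefficients. -/
instance finiteDimensional_feSubmodule : FiniteDimensional ℝ (T.feSubmodule 2) := by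
  let Φ : (T.triangles → ℝ × (Plane →L[ℝ] ℝ) × (Plane →L[ℝ] Plane →L[ℝ] ℝ)) →ₗ[ℝ]
      ((t : T.triangles) → region (t : Finset Plane) → ℝ) :=
    { toFun := fun q t x => (q t).1 + (q t).2.1 x + (q t).2.2 x x
      map_add' := fun q q' => by
        ext t x
        simp
        ring
      map_smul' := fun a q => by
        ext t x
        simp
        ring }
  let R : T.feSubmodule 2 →ₗ[ℝ] ((t : T.triangles) → region (t : Finset Plane) → ℝ) :=
    { toFun := fun u t x => zeroExt (u : C(closure Ω, ℝ)) x
      map_add' := fun u v => by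
        ext t x
        simp [zeroExt_add]
      map_smul' := fun a u => by
        ext t x
        simp [zeroExt_smul] }
  have hR : ∀ u, R u ∈ LinearMap.range Φ := by
    intro u
    choose c A B h using fun t : T.triangles => isQuadOn_zeroExt u.2 t.2
    refine ⟨fun t => (c t, A t, B t), ?_⟩
    ext t x
    exact (h t x x.2).symm
  refine Module.Finite.of_injective (R.codRestrict (LinearMap.range Φ) hR) fun u v huv => ?_
  have huv' : R u = R v := congrArg Subtype.val huv
  ext x
  obtain ⟨t, ht, hx⟩ := exists_mem_region (T := T) x.2
  rw [← zeroExt_coe, ← zeroExt_coe]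
  exact congrFun (congrFun huv' ⟨t, ht⟩) ⟨x, hx⟩

variable (T) in
/-- The functions of mean zero in the Lagrange finite element space. -/
noncomputable def meanZero (k : ℕ) (hb : Bornology.IsBounded Ω) : Submodule ℝ C(closure Ω, ℝ) :=
  T.feSubmodule k ⊓ LinearMap.ker (omegaIntegral hb)

instance finiteDimensional_meanZero (hb : Bornology.IsBounded Ω) :
    FiniteDimensional ℝ (T.meanZero 2 hb) :=
  Submodule.finiteDimensional_inf_left _ _

lemma mem_meanZero_iff {k : ℕ} {hb : Bornology.IsBounded Ω} {v : C(closure Ω, ℝ)} :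
    v ∈ T.meanZero k hb ↔ v ∈ T.feSpace k ∧ l2 v 1 = 0 := by
  rw [l2_eq hb, mul_one]
  rfl

lemma coe_meanZero_one (hb : Bornology.IsBounded Ω) :
    (T.meanZero 1 hb : Set C(closure Ω, ℝ)) = T.V₀ :=
  Set.ext fun _ => mem_meanZero_iff

lemma coe_meanZero_two (hb : Bornology.IsBounded Ω) :
    (T.meanZero 2 hb : Set C(closure Ω, ℝ)) = T.Z₀ :=
  Set.ext fun _ => mem_meanZero_iff

lemma meanZero_one_le_two (hb : Bornology.IsBounded Ω) : T.meanZero 1 hb ≤ T.meanZero 2 hb :=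
  inf_le_inf_right _ T.V_subset_Z

lemma gradIP_self_nonneg (u : C(closure Ω, ℝ)) : 0 ≤ T.gradIP u u :=
  Finset.sum_nonneg fun _ _ => integral_nonneg fun _ => real_inner_self_nonneg

lemma norm2hSq_nonneg {α : ℝ} (hα : 0 ≤ α) (u : C(closure Ω, ℝ)) : 0 ≤ T.norm2hSq α u :=
  add_nonneg
    (Finset.sum_nonneg fun _ _ => integral_nonneg fun _ => hessProd_self_nonneg _ _ _)
    (Finset.sum_nonneg fun _ _ => mul_nonneg (div_nonneg hα Metric.diam_nonneg)
      (integral_nonneg fun _ => sq_nonneg _))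

section ShapeRegular

variable {σ : ℝ} (hT : T.ShapeRegular σ)
include hT

lemma ShapeRegular.gradIP_add_left {u v w : C(closure Ω, ℝ)} (hu : u ∈ T.feSubmodule 2)
    (hv : v ∈ T.feSubmodule 2) (hw : w ∈ T.feSubmodule 2) :
    T.gradIP (u + v) w = T.gradIP u w + T.gradIP v w :=
  hT.isBilin_gradIP.add_left ⟨u, hu⟩ ⟨v, hv⟩ ⟨w, hw⟩

lemma ShapeRegular.gradIP_smul_left (a : ℝ) {u w : C(closure Ω, ℝ)} (hu : u ∈ T.feSubmodule 2)
    (hw : w ∈ T.feSubmodule 2) : T.gradIP (a • u) w = a * T.gradIP u w :=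
  hT.isBilin_gradIP.smul_left a ⟨u, hu⟩ ⟨w, hw⟩

lemma ShapeRegular.aIP_add_left (α : ℝ) {u v w : C(closure Ω, ℝ)} (hu : u ∈ T.feSubmodule 2)
    (hv : v ∈ T.feSubmodule 2) (hw : w ∈ T.feSubmodule 2) :
    T.aIP α (u + v) w = T.aIP α u w + T.aIP α v w :=
  (hT.isBilin_aIP α).add_left ⟨u, hu⟩ ⟨v, hv⟩ ⟨w, hw⟩

lemma ShapeRegular.gradIP_add_cst {u w : C(closure Ω, ℝ)} (hu : u ∈ T.feSubmodule 2)
    (hw : w ∈ T.feSubmodule 2) (c : ℝ) : T.gradIP (u + cst c) w = T.gradIP u w := by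
  rw [hT.gradIP_add_left hu (T.cst_mem_feSubmodule 2 c) hw, gradIP_cst, add_zero]

lemma ShapeRegular.aIP_add_cst (α : ℝ) {u w : C(closure Ω, ℝ)} (hu : u ∈ T.feSubmodule 2)
    (hw : w ∈ T.feSubmodule 2) (c : ℝ) : T.aIP α (u + cst c) w = T.aIP α u w := by
  rw [hT.aIP_add_left α hu (T.cst_mem_feSubmodule 2 c) hw, aIP_cst, add_zero]

variable (hΩ : IsPolygonalDomain Ω)
include hΩ

omit hT in
lemma volumeReal_pos : 0 < volume.real Ω :=
  ENNReal.toReal_pos (hΩ.isOpen.measure_pos _ hΩ.isConnected.nonempty).ne'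
    hΩ.isBounded.measure_lt_top.ne

lemma ShapeRegular.eq_zero_of_gradIP_self {u : C(closure Ω, ℝ)}
    (hu : u ∈ T.meanZero 2 hΩ.isBounded) (h : T.gradIP u u = 0) : u = 0 := by
  obtain ⟨c, hc⟩ := hT.exists_eq_cst_of_gradIP_self hΩ.isConnected ⟨u, hu.1⟩ h
  change u = cst c at hc
  have h0 : omegaIntegral hΩ.isBounded u = 0 := hu.2
  rw [hc, omegaIntegral_cst _ hΩ.isOpen] at h0
  have : c = 0 := (mul_eq_zero.1 h0).resolve_left (volumeReal_pos hΩ).ne'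
  rw [hc, this, cst_eq_smul, zero_smul]

variable {X : Submodule ℝ C(closure Ω, ℝ)} (hX : X ≤ T.meanZero 2 hΩ.isBounded)
include hX

/-- Riesz representation: the gradient form is definite on mean-zero functions. It holds for every
subspace `X`, which covers `V₀` and `Z₀` at once. -/
lemma ShapeRegular.existsUnique_isInvLaplacian (ζ : C(closure Ω, ℝ)) :
    ∃! χ, T.IsInvLaplacian X ζ χ := by
  have : FiniteDimensional ℝ X := Submodule.finiteDimensional_of_le hX
  have hX2 : X ≤ T.feSubmodule 2 := hX.trans inf_le_left
  obtain ⟨P, hP⟩ := hT.isBilin_gradIP.comp (Submodule.inclusion hX2)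
  have hpos : ∀ v, P v v = 0 → v = 0 := by
    intro v hv
    rw [← hP] at hv
    exact Subtype.ext (hT.eq_zero_of_gradIP_self hΩ (hX v.2) hv)
  have hiff : ∀ w : X, T.IsInvLaplacian X ζ w ↔
      P w = omegaIntegral hΩ.isBounded ∘ₗ LinearMap.mulLeft ℝ ζ ∘ₗ X.subtype := by
    intro w
    constructor
    · rintro ⟨-, h⟩
      ext v
      rw [← hP]
      exact (h v v.2).trans (l2_eq hΩ.isBounded _ _)
    · intro h
      refine ⟨w.2, fun η hη => ?_⟩
      rw [l2_eq hΩ.isBounded]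
      exact (hP w ⟨η, hη⟩).trans (by rw [h]; rfl)
  obtain ⟨w, hw, huniq⟩ := existsUnique_riesz hpos
    (omegaIntegral hΩ.isBounded ∘ₗ LinearMap.mulLeft ℝ ζ ∘ₗ X.subtype)
  refine ⟨w, (hiff w).2 hw, fun χ hχ => ?_⟩
  exact congrArg Subtype.val (huniq ⟨χ, hχ.1⟩ ((hiff ⟨χ, hχ.1⟩).1 hχ))

lemma ShapeRegular.isInvLaplacian_invLaplacian (ζ : C(closure Ω, ℝ)) :
    T.IsInvLaplacian X ζ (T.invLaplacian X ζ) :=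
  Classical.epsilon_spec (hT.existsUnique_isInvLaplacian hΩ hX ζ).exists

lemma ShapeRegular.invLaplacian_eq {ζ χ : C(closure Ω, ℝ)} (h : T.IsInvLaplacian X ζ χ) :
    T.invLaplacian X ζ = χ :=
  (hT.existsUnique_isInvLaplacian hΩ hX ζ).unique (hT.isInvLaplacian_invLaplacian hΩ hX ζ) h

lemma ShapeRegular.isLinearMap_invLaplacian :
    IsLinearMap ℝ (T.invLaplacian (X : Set C(closure Ω, ℝ))) := by
  have hX2 : X ≤ T.feSubmodule 2 := hX.trans inf_le_left
  have hspec := hT.isInvLaplacian_invLaplacian hΩ hX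
  refine ⟨fun u v => hT.invLaplacian_eq hΩ hX ⟨X.add_mem (hspec u).1 (hspec v).1, fun η hη => ?_⟩,
    fun a u => hT.invLaplacian_eq hΩ hX ⟨X.smul_mem a (hspec u).1, fun η hη => ?_⟩⟩
  · rw [hT.gradIP_add_left (hX2 (hspec u).1) (hX2 (hspec v).1) (hX2 hη), (hspec u).2 η hη,
      (hspec v).2 η hη, l2_eq hΩ.isBounded, l2_eq hΩ.isBounded, l2_eq hΩ.isBounded, add_mul, map_add]
  · rw [hT.gradIP_smul_left a (hX2 (hspec u).1) (hX2 hη), (hspec u).2 η hη,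
      l2_eq hΩ.isBounded, l2_eq hΩ.isBounded, smul_mul_assoc, map_smul, smul_eq_mul]

end ShapeRegular

end Triangulation

/-! ### The quartic potential: tangent inequality and second-order upper bound. -/

section Quartic

variable {Ω : Set Plane} (hb : Bornology.IsBounded Ω) (a w : C(closure Ω, ℝ))

lemma omegaIntegral_pow_four_add_le :
    1 / 4 * omegaIntegral hb (a ^ 4) + omegaIntegral hb (a ^ 3 * w) ≤
      1 / 4 * omegaIntegral hb ((a + w) ^ 4) := by
  -- The Taylor remainder of the fourth power, written as a sum of squares.
  have h : (a + w) ^ 4 =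
      a ^ 4 + (4 : ℝ) • (a ^ 3 * w) + ((w * (w + a + a)) ^ 2 + (a * w) ^ 2 + (a * w) ^ 2) := by
    ext x
    simp
    ring
  have h0 : 0 ≤ omegaIntegral hb ((w * (w + a + a)) ^ 2 + (a * w) ^ 2 + (a * w) ^ 2) :=
    omegaIntegral_nonneg hb fun x => by
      simp only [ContinuousMap.add_apply, ContinuousMap.pow_apply]
      positivity
  rw [h, map_add, map_add, map_smul, smul_eq_mul]
  linarith

lemma omegaIntegral_pow_four_add_smul_le {s : ℝ} (h0 : 0 ≤ s) (h1 : s ≤ 1) :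
    1 / 4 * omegaIntegral hb ((a + s • w) ^ 4) ≤
      1 / 4 * omegaIntegral hb (a ^ 4) + s * omegaIntegral hb (a ^ 3 * w) +
        s ^ 2 * (1 / 4 * omegaIntegral hb ((8 : ℝ) • (a * w) ^ 2 + (3 : ℝ) • w ^ 4)) := by
  -- The gap in the upper bound is `2s²(aw - sw²)² + 3s²(1 - s²)w⁴`, which is nonnegative for `0 ≤ s
  -- ≤ 1`.
  have h : a ^ 4 + (4 * s) • (a ^ 3 * w) + s ^ 2 • ((8 : ℝ) • (a * w) ^ 2 + (3 : ℝ) • w ^ 4) =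
      (a + s • w) ^ 4 +
        ((2 * s ^ 2) • (a * w - s • w ^ 2) ^ 2 + (3 * s ^ 2 * (1 - s ^ 2)) • w ^ 4) := by
    ext x
    simp
    ring
  have h2 : 0 ≤ omegaIntegral hb
      ((2 * s ^ 2) • (a * w - s • w ^ 2) ^ 2 + (3 * s ^ 2 * (1 - s ^ 2)) • w ^ 4) :=
    omegaIntegral_nonneg hb fun x => by
      have : 0 ≤ 1 - s ^ 2 := by nlinarith
      simp only [ContinuousMap.add_apply, ContinuousMap.pow_apply, ContinuousMap.smul_apply,
        smul_eq_mul]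
      positivity
  have h3 := congrArg (omegaIntegral hb) h
  simp only [map_add _ (_ + _), map_add _ (a ^ 4), map_smul, smul_eq_mul] at h3
  rw [map_add _ ((a + s • w) ^ 4)] at h3
  linarith

end Quartic

/-! ### The functional `G` as a convex energy. -/

namespace Triangulation

variable {Ω : Set Plane} {T : Triangulation Ω} {σ : ℝ} (hT : T.ShapeRegular σ)
  (hΩ : IsPolygonalDomain Ω)

lemma integral_abs_zeroExt_pow (hb : Bornology.IsBounded Ω) (v : C(closure Ω, ℝ)) {n : ℕ}
    (hn : Even n) (hn0 : n ≠ 0) : ∫ x in Ω, |zeroExt v x| ^ n = omegaIntegral hb (v ^ n) := by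
  rw [omegaIntegral_apply]
  congr 1
  ext x
  rw [hn.pow_abs]
  by_cases hx : x ∈ closure Ω
  · simp [zeroExt_of_mem _ hx]
  · simp [zeroExt_of_notMem _ hx, hn0]

lemma l2_add_left (hb : Bornology.IsBounded Ω) (u v w : C(closure Ω, ℝ)) :
    l2 (u + v) w = l2 u w + l2 v w := by
  simp only [l2_eq hb, add_mul, map_add]

lemma l2_smul_left (hb : Bornology.IsBounded Ω) (a : ℝ) (u w : C(closure Ω, ℝ)) :
    l2 (a • u) w = a * l2 u w := by
  simp only [l2_eq hb, smul_mul_assoc, map_smul, smul_eq_mul]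

lemma l2_comm (u v : C(closure Ω, ℝ)) : l2 u v = l2 v u := by
  simp only [l2, mul_comm]

lemma l2_cst_left (hb : Bornology.IsBounded Ω) (c : ℝ) (w : C(closure Ω, ℝ)) :
    l2 (cst c) w = c * l2 w 1 := by
  rw [cst_eq_smul, l2_smul_left hb, l2_comm]

include hT in
/-- The functional `G` on the mean-zero space, with its derivative. -/
lemma ShapeRegular.exists_isSplitEnergy [CompactSpace (closure Ω)]
    {X E : Submodule ℝ C(closure Ω, ℝ)} (hX : X ≤ T.meanZero 2 hΩ.isBounded)
    (hE : E ≤ T.meanZero 2 hΩ.isBounded) {α τ ε : ℝ}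
    (hα : 2 * (24 * σ ^ 2 + 1) ≤ α) (hτ : 0 < τ) (hε : ε < 1) (c : ℝ) (φp : E) :
    ∃ (B : E →ₗ[ℝ] E →ₗ[ℝ] ℝ) (ℓ : E →ₗ[ℝ] ℝ) (Q : E → ℝ) (D : E → E →ₗ[ℝ] ℝ) (C : ℝ)
      (P : E →ₗ[ℝ] E →ₗ[ℝ] ℝ),
      IsSplitEnergy (fun φ : E => T.G X α τ ε c φp φ) B ℓ Q D C ∧
      (∀ v, v ≠ 0 → 0 < P v v) ∧
      (∀ v : E, 1 / 2 * T.norm2hSq α (v : C(closure Ω, ℝ)) + P v v ≤ B v v) ∧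
      ∀ z w : E, B z w + ℓ w + D z w =
        T.gradIP (T.invLaplacian X (τ⁻¹ • ((z : C(closure Ω, ℝ)) - φp))) (T.invLaplacian X w)
        + T.aIP α z w + l2 (((z : C(closure Ω, ℝ)) + cst c) ^ 3) w
        + (1 - ε) * l2 ((z : C(closure Ω, ℝ)) + cst c) w - 2 * T.gradIP φp w := by
  set I := omegaIntegral hΩ.isBounded with hI
  have hE2 : E ≤ T.feSubmodule 2 := hE.trans inf_le_left
  have hX2 : X ≤ T.feSubmodule 2 := hX.trans inf_le_left
  have hspec := hT.isInvLaplacian_invLaplacian hΩ hX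
  let S : E →ₗ[ℝ] T.feSubmodule 2 :=
    (IsLinearMap.mk' _ (hT.isLinearMap_invLaplacian hΩ hX)).restrict fun u _ => hX2 (hspec u).1
  obtain ⟨N, hN⟩ := hT.isBilin_gradIP.comp S
  obtain ⟨A, hA⟩ := (hT.isBilin_aIP α).comp (Submodule.inclusion hE2)
  obtain ⟨Γ, hΓ⟩ := hT.isBilin_gradIP.comp (Submodule.inclusion hE2)
  obtain ⟨P, hP⟩ : ∃ P : E →ₗ[ℝ] E →ₗ[ℝ] ℝ, ∀ u v : E, P u v = (1 - ε) * I (u * v) :=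
    ⟨(1 - ε) • ((LinearMap.mul ℝ C(closure Ω, ℝ)).compr₂ I).compl₁₂ E.subtype E.subtype,
      fun _ _ => rfl⟩
  replace hN : ∀ u v : E, N u v = T.gradIP (T.invLaplacian X u) (T.invLaplacian X v) :=
    fun u v => (hN u v).symm
  replace hA : ∀ u v : E, A u v = T.aIP α u v := fun u v => (hA u v).symm
  replace hΓ : ∀ u v : E, Γ u v = T.gradIP u v := fun u v => (hΓ u v).symm
  have hI0 : ∀ u : E, I u = 0 := fun u => (hE u.2).2
  have hε' : 0 < 1 - ε := by linarith
  have hPpos : ∀ v, v ≠ 0 → 0 < P v v := by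
    intro v hv
    rw [hP]
    refine mul_pos hε' (lt_of_le_of_ne ?_ fun h => hv (Subtype.ext ?_))
    · exact omegaIntegral_nonneg _ fun x => mul_self_nonneg _
    · exact eq_zero_of_omegaIntegral_mul_self hΩ.isBounded hΩ.isOpen h.symm
  have hNpos : ∀ v, 0 ≤ N v v := fun v => by rw [hN]; exact gradIP_self_nonneg _
  have hαpos : 0 ≤ α := le_trans (by positivity) hα
  have hBP : ∀ v : E, 1 / 2 * T.norm2hSq α (v : C(closure Ω, ℝ)) + P v v ≤ (τ⁻¹ • N + A + P) v v := by
    intro v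
    have h1 := hT.half_norm2hSq_le_aIP hα ⟨v, hE2 v.2⟩
    have h2 : 0 ≤ τ⁻¹ * N v v := mul_nonneg (inv_nonneg.2 hτ.le) (hNpos v)
    simp only [LinearMap.add_apply, LinearMap.smul_apply, smul_eq_mul, hA]
    linarith
  -- Expanding the square in the negative norm puts `N` into the quadratic part, `N φp` into the
  -- linear part and `N φp φp` into the constant.
  refine ⟨τ⁻¹ • N + A + P, -(τ⁻¹ • N φp) - (2 : ℝ) • Γ φp,
    fun φ => 1 / 4 * I (((φ : C(closure Ω, ℝ)) + cst c) ^ 4),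
    fun z => I ∘ₗ LinearMap.mulLeft ℝ (((z : C(closure Ω, ℝ)) + cst c) ^ 3) ∘ₗ E.subtype,
    τ⁻¹ / 2 * N φp φp + (1 - ε) / 2 * (c * c * I 1), P, ⟨?_, ?_, ?_, ?_, ?_, ?_⟩, hPpos, hBP, ?_⟩
  · intro u v
    simp only [LinearMap.add_apply, LinearMap.smul_apply, smul_eq_mul, hA, hN, hP,
      gradIP_comm (T.invLaplacian X u), aIP_comm α (u : C(closure Ω, ℝ)),
      mul_comm (u : C(closure Ω, ℝ))]
  · intro v hv
    have := hPpos v hv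
    have h1 := norm2hSq_nonneg (T := T) hαpos (v : C(closure Ω, ℝ))
    linarith [hBP v]
  · intro v
    refine mul_nonneg (by norm_num) (omegaIntegral_nonneg _ fun x => ?_)
    simp only [ContinuousMap.pow_apply]
    positivity
  · intro z w
    have := omegaIntegral_pow_four_add_le hΩ.isBounded ((z : C(closure Ω, ℝ)) + cst c) w
    rw [add_right_comm] at this
    exact this
  · intro z w
    refine ⟨1 / 4 * I ((8 : ℝ) • (((z : C(closure Ω, ℝ)) + cst c) * (w : C(closure Ω, ℝ))) ^ 2
      + (3 : ℝ) • (w : C(closure Ω, ℝ)) ^ 4), fun s h0 h1 => ?_⟩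
    have := omegaIntegral_pow_four_add_smul_le hΩ.isBounded ((z : C(closure Ω, ℝ)) + cst c) w h0 h1
    rw [add_right_comm] at this
    exact this
  · intro v
    have h4 := integral_abs_zeroExt_pow hΩ.isBounded ((v : C(closure Ω, ℝ)) + cst c) (n := 4)
      (by decide) (by norm_num)
    have h2 := integral_abs_zeroExt_pow hΩ.isBounded ((v : C(closure Ω, ℝ)) + cst c) (n := 2)
      (by decide) (by norm_num)
    -- The cross term `2c ∫ v` vanishes because `v` has mean zero.
    have hsq : I (((v : C(closure Ω, ℝ)) + cst c) ^ 2) = I ((v : C(closure Ω, ℝ)) * (v : C(closure Ω, ℝ))) + c * c * I 1 := by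
      have : ((v : C(closure Ω, ℝ)) + cst c) ^ 2
          = (v : C(closure Ω, ℝ)) * (v : C(closure Ω, ℝ)) + (2 * c) • (v : C(closure Ω, ℝ)) + (c * c) • 1 := by
        ext x
        simp [cst]
        ring
      rw [this, map_add, map_add, map_smul, map_smul, hI0, smul_zero, add_zero, smul_eq_mul]
    have hneg : T.negNormSq X (τ⁻¹ • ((v : C(closure Ω, ℝ)) - φp)) =
        N (τ⁻¹ • (v - φp)) (τ⁻¹ • (v - φp)) := by
      rw [hN, Submodule.coe_smul, Submodule.coe_sub, negNormSq]
    have hsymm : N v φp = N φp v := by rw [hN, hN, gradIP_comm]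
    simp only [G]
    rw [h4, h2, hneg, ← hI, hsq, ← hA, ← hΓ]
    simp only [map_smul, map_sub, LinearMap.smul_apply, LinearMap.sub_apply, LinearMap.add_apply,
      LinearMap.neg_apply, smul_eq_mul, hP, hsymm]
    field_simp
    ring
  · intro z w
    have hz : T.gradIP (T.invLaplacian X (τ⁻¹ • ((z : C(closure Ω, ℝ)) - φp))) (T.invLaplacian X w) =
        N (τ⁻¹ • (z - φp)) w := by
      rw [hN, Submodule.coe_smul, Submodule.coe_sub]
    have hD : (I ∘ₗ LinearMap.mulLeft ℝ (((z : C(closure Ω, ℝ)) + cst c) ^ 3) ∘ₗ E.subtype) w =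
        l2 (((z : C(closure Ω, ℝ)) + cst c) ^ 3) w := (l2_eq hΩ.isBounded _ _).symm
    have hw : l2 (w : C(closure Ω, ℝ)) 1 = 0 := (mem_meanZero_iff.1 (hE w.2)).2
    rw [hz, hD, l2_add_left hΩ.isBounded, l2_cst_left hΩ.isBounded, hw, l2_eq hΩ.isBounded z w,
      ← hI, ← hA, ← hΓ]
    simp only [map_smul, map_sub, LinearMap.smul_apply, LinearMap.sub_apply, LinearMap.add_apply,
      LinearMap.neg_apply, smul_eq_mul, hP]
    ring

end Triangulation

/-! ### Minimizers, the mean-zero scheme and its equivalence with the full scheme. -/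

namespace Triangulation

variable {Ω : Set Plane} {T : Triangulation Ω} {σ : ℝ}

lemma l2_sub_left (hb : Bornology.IsBounded Ω) (u v w : C(closure Ω, ℝ)) :
    l2 (u - v) w = l2 u w - l2 v w := by
  simp only [l2_eq hb, sub_mul, map_sub]

lemma l2_one_one (hΩ : IsPolygonalDomain Ω) : l2 (1 : C(closure Ω, ℝ)) 1 = volume.real Ω := by
  have := omegaIntegral_cst hΩ.isBounded hΩ.isOpen 1
  rw [cst_eq_smul, one_smul, mul_one] at this
  rw [l2_eq hΩ.isBounded, mul_one, this]

lemma mean_mul_volume (hΩ : IsPolygonalDomain Ω) (u : C(closure Ω, ℝ)) :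
    mean u * volume.real Ω = l2 u 1 := by
  rw [mean, mul_comm, mul_inv_cancel_left₀ (volumeReal_pos hΩ).ne']

lemma l2_sub_cst_mean (hΩ : IsPolygonalDomain Ω) (u : C(closure Ω, ℝ)) :
    l2 (u - cst (mean u)) 1 = 0 := by
  rw [l2_sub_left hΩ.isBounded, l2_cst_left hΩ.isBounded, l2_one_one hΩ, mean_mul_volume hΩ, sub_self]

lemma sub_cst_mem (k : ℕ) {u : C(closure Ω, ℝ)} (hu : u ∈ T.feSpace k) (c : ℝ) :
    u - cst c ∈ T.feSpace k :=
  (T.feSubmodule k).sub_mem hu (T.cst_mem_feSubmodule k c)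

lemma add_cst_mem (k : ℕ) {u : C(closure Ω, ℝ)} (hu : u ∈ T.feSpace k) (c : ℝ) :
    u + cst c ∈ T.feSpace k :=
  (T.feSubmodule k).add_mem hu (T.cst_mem_feSubmodule k c)

variable (hT : T.ShapeRegular σ) (hΩ : IsPolygonalDomain Ω)

include hΩ in
lemma sub_cst_mean_mem_Z₀ {u : C(closure Ω, ℝ)} (hu : u ∈ T.Z) : u - cst (mean u) ∈ T.Z₀ :=
  ⟨sub_cst_mem 2 hu _, l2_sub_cst_mean hΩ u⟩

include hΩ in
lemma compactSpace_closure : CompactSpace (closure Ω) :=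
  isCompact_iff_compactSpace.1 hΩ.isBounded.isCompact_closure

include hΩ in
lemma exists_submodule_of_eq {X : Set C(closure Ω, ℝ)} (hX : X = T.V₀ ∨ X = T.Z₀) :
    ∃ Y : Submodule ℝ C(closure Ω, ℝ), X = Y ∧ Y ≤ T.meanZero 2 hΩ.isBounded := by
  rcases hX with rfl | rfl
  · exact ⟨_, (coe_meanZero_one hΩ.isBounded).symm, meanZero_one_le_two _⟩
  · exact ⟨_, (coe_meanZero_two hΩ.isBounded).symm, le_rfl⟩

include hT hΩ

theorem ShapeRegular.energy_convex_coercive {X : Set C(closure Ω, ℝ)} (hX : X = T.V₀ ∨ X = T.Z₀)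
    {α τ ε : ℝ} (hα : 2 * (24 * σ ^ 2 + 1) ≤ α) (hτ : 0 < τ) (hε : ε < 1)
    {φp : C(closure Ω, ℝ)} (hφp : φp ∈ T.Z₀) (c : ℝ) :
    StrictConvexOn ℝ T.Z₀ (T.G X α τ ε c φp) ∧
    (∃ γ β : ℝ, 0 < γ ∧ 0 ≤ β ∧ ∀ φ ∈ T.Z₀, γ * T.norm2hSq α φ - β ≤ T.G X α τ ε c φp φ) ∧
    ∃! φ, φ ∈ T.Z₀ ∧ IsMinOn (T.G X α τ ε c φp) T.Z₀ φ := by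
  have := compactSpace_closure hΩ
  obtain ⟨X, rfl, hX'⟩ := exists_submodule_of_eq hΩ hX
  rw [← coe_meanZero_two hΩ.isBounded] at hφp ⊢
  obtain ⟨B, ℓ, Q, D, C, P, hG, hP, hBP, -⟩ :=
    hT.exists_isSplitEnergy hΩ hX' le_rfl hα hτ hε c ⟨φp, hφp⟩
  refine ⟨⟨(T.meanZero 2 hΩ.isBounded).convex, fun x hx y hy hxy a b ha hb hab => ?_⟩, ?_, ?_⟩
  · exact hG.strictConvexOn.2 (x := ⟨x, hx⟩) (mem_univ _) (y := ⟨y, hy⟩) (mem_univ _)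
      (fun h => hxy (congrArg Subtype.val h)) ha hb hab
  · obtain ⟨β, hβ0, hβ⟩ := hG.coercive hP hBP
    -- One factor `1/2` comes from the energy, the other from the coercivity of the penalty form.
    refine ⟨1 / 4, β, by norm_num, hβ0, fun φ hφ => ?_⟩
    have := hβ ⟨φ, hφ⟩
    simp only at this
    linarith
  · obtain ⟨z, hz, huniq⟩ := hG.existsUnique_min
    refine ⟨z, ⟨z.2, fun y hy => hz ⟨y, hy⟩⟩, fun y hy => ?_⟩
    exact congrArg Subtype.val (huniq ⟨y, hy.1⟩ fun w => hy.2 w.2)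

/-- Equation (∗∗) says precisely that `μ` is the discrete inverse Laplacian of `-(φ - φp)/τ` in
`V₀`. -/
lemma ShapeRegular.existsUnique_meanZeroEqMu {τ : ℝ} (φp φ : C(closure Ω, ℝ)) :
    ∃! μ, μ ∈ T.V₀ ∧ T.MeanZeroEqMu τ φp φ μ := by
  have h := hT.existsUnique_isInvLaplacian hΩ (meanZero_one_le_two hΩ.isBounded)
    (-(τ⁻¹ • (φ - φp)))
  rw [coe_meanZero_one] at h
  have hneg : ∀ ν, l2 (-(τ⁻¹ • (φ - φp))) ν = -l2 (τ⁻¹ • (φ - φp)) ν := fun ν => by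
    rw [← neg_one_smul ℝ, l2_smul_left hΩ.isBounded, neg_one_mul]
  simp only [IsInvLaplacian, hneg] at h
  exact h

/-- Minimizing the energy is the same as solving the mean-zero scheme. -/
theorem ShapeRegular.isMinOn_iff_meanZeroEqPhi {α τ ε : ℝ} (hα : 2 * (24 * σ ^ 2 + 1) ≤ α)
    (hτ : 0 < τ) (hε : ε < 1) {φp φ μ : C(closure Ω, ℝ)} (hφp : φp ∈ T.Z₀) (c : ℝ)
    (hφ : φ ∈ T.Z₀) (hμ : μ ∈ T.V₀) (hμφ : T.MeanZeroEqMu τ φp φ μ) :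
    IsMinOn (T.G T.V₀ α τ ε c φp) T.Z₀ φ ↔ T.MeanZeroEqPhi α ε c φp φ μ := by
  have := compactSpace_closure hΩ
  have hV := meanZero_one_le_two (T := T) hΩ.isBounded
  have hspec := hT.isInvLaplacian_invLaplacian hΩ hV
  set ζ := τ⁻¹ • (φ - φp) with hζ
  have hinv : T.invLaplacian (T.meanZero 1 hΩ.isBounded) ζ = (-1 : ℝ) • μ := by
    have hμ' : μ ∈ T.meanZero 1 hΩ.isBounded := mem_meanZero_iff.2 hμ
    refine hT.invLaplacian_eq hΩ hV ⟨Submodule.smul_mem _ _ hμ', fun η hη => ?_⟩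
    rw [hT.gradIP_smul_left _ (hV hμ').1 (hV hη).1, hμφ η (mem_meanZero_iff.1 hη)]
    ring
  -- Testing the defining equation of `T_h w` with `T_h ζ = -μ` turns the derivative of the negative
  -- norm into `-(μ, w)`.
  have hN : ∀ w, T.gradIP (T.invLaplacian (T.meanZero 1 hΩ.isBounded) ζ)
      (T.invLaplacian (T.meanZero 1 hΩ.isBounded) w) = -l2 μ w := by
    intro w
    rw [gradIP_comm, (hspec w).2 _ (hspec ζ).1, hinv, l2_comm, l2_smul_left hΩ.isBounded]
    ring
  rw [MeanZeroEqPhi, ← coe_meanZero_one hΩ.isBounded]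
  rw [← coe_meanZero_two hΩ.isBounded] at hφp hφ ⊢
  obtain ⟨B, ℓ, Q, D, C, P, hG, -, -, hD⟩ :=
    hT.exists_isSplitEnergy hΩ hV le_rfl hα hτ hε c ⟨φp, hφp⟩
  have hmin := hG.isMinOn_iff ⟨φ, hφ⟩
  constructor
  · intro h ψ hψ
    have h1 := hmin.1 (fun y => h y.2) ⟨ψ, hψ⟩
    rw [hD] at h1
    simp only [← hζ, hN] at h1
    linarith
  · intro h y hy
    refine hmin.2 (fun w => ?_) ⟨y, hy⟩
    have h1 := h w w.2
    rw [hD]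
    simp only [← hζ, hN]
    linarith

theorem ShapeRegular.existsUnique_meanZeroSolution {α τ ε : ℝ} (hα : 2 * (24 * σ ^ 2 + 1) ≤ α)
    (hτ : 0 < τ) (hε : ε < 1) {φp : C(closure Ω, ℝ)} (hφp : φp ∈ T.Z₀) (c : ℝ) :
    ∃! s, s ∈ T.meanZeroSolutions α τ ε c φp := by
  obtain ⟨φ, ⟨hφ, hmin⟩, huniq⟩ :=
    (hT.energy_convex_coercive hΩ (.inl rfl) hα hτ hε hφp c).2.2
  obtain ⟨μ, ⟨hμ, hμφ⟩, huniqμ⟩ := hT.existsUnique_meanZeroEqMu hΩ (τ := τ) φp φ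
  refine ⟨(φ, μ), ⟨hφ, hμ, ?_, hμφ⟩, ?_⟩
  · exact (hT.isMinOn_iff_meanZeroEqPhi hΩ hα hτ hε hφp c hφ hμ hμφ).1 hmin
  · rintro ⟨φ', μ'⟩ ⟨hφ', hμ', heq, hμφ'⟩
    obtain rfl : φ' = φ := huniq φ'
      ⟨hφ', (hT.isMinOn_iff_meanZeroEqPhi hΩ hα hτ hε hφp c hφ' hμ' hμφ').2 heq⟩
    obtain rfl : μ' = μ := huniqμ μ' ⟨hμ', hμφ'⟩
    rfl

/-- Shifting by mean values identifies the mean-zero scheme with the original one. -/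
theorem ShapeRegular.bijOn_lift (α : ℝ) {τ : ℝ} (hτ : 0 < τ) (ε : ℝ) {φp : C(closure Ω, ℝ)}
    (hφp : φp ∈ T.Z) : Set.BijOn (Triangulation.lift ε (mean φp))
      (T.meanZeroSolutions α τ ε (mean φp) (φp - cst (mean φp))) (T.schemeSolutions α τ ε φp) := by
  have hb := hΩ.isBounded
  set c := mean φp with hc
  have hφp2 : φp ∈ T.feSubmodule 2 := hφp
  have hV2 : ∀ {v}, v ∈ T.V → v ∈ T.feSubmodule 2 := fun hv => T.V_subset_Z hv
  have hgp : ∀ ψ ∈ T.feSubmodule 2, T.gradIP (φp - cst c) ψ = T.gradIP φp ψ := by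
    intro ψ hψ
    have h := hT.gradIP_add_cst (sub_cst_mem 2 hφp2 c) hψ c
    rw [sub_add_cancel] at h
    exact h.symm
  have hgr : ∀ u ∈ T.feSubmodule 2, ∀ v ∈ T.feSubmodule 2, ∀ m : ℝ,
      T.gradIP u (v - cst m) = T.gradIP u v := by
    intro u hu v hv m
    have h := hT.gradIP_add_cst (sub_cst_mem 2 hv m) hu m
    rw [sub_add_cancel] at h
    rw [gradIP_comm, ← h, gradIP_comm]
  have har : ∀ u ∈ T.feSubmodule 2, ∀ v ∈ T.feSubmodule 2, ∀ m : ℝ,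
      T.aIP α u (v - cst m) = T.aIP α u v := by
    intro u hu v hv m
    have h := hT.aIP_add_cst α (sub_cst_mem 2 hv m) hu m
    rw [sub_add_cancel] at h
    rw [aIP_comm, ← h, aIP_comm]
  have hlr : ∀ u v : C(closure Ω, ℝ), ∀ m : ℝ, l2 u (v - cst m) = l2 u v - m * l2 u 1 := by
    intro u v m
    rw [l2_comm, l2_sub_left hb, l2_cst_left hb, l2_comm v]
  have hF : ∀ u v : C(closure Ω, ℝ),
      l2 (u ^ 3 + (1 - ε) • u) v = l2 (u ^ 3) v + (1 - ε) * l2 u v := fun u v => by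
    rw [l2_add_left hb, l2_smul_left hb]
  have hvol := volumeReal_pos hΩ
  refine ⟨?_, ?_, ?_⟩
  · rintro ⟨φ, μ⟩ ⟨hφ, hμ, h1, h2⟩
    simp only at hφ hμ h1 h2
    refine ⟨add_cst_mem 2 hφ.1 c, add_cst_mem 1 hμ.1 _, fun ν hν => ?_, fun ψ hψ => ?_⟩
    · simp only [lift]
      have h := h2 (ν - cst (mean ν)) ⟨sub_cst_mem 1 hν _, l2_sub_cst_mean hΩ ν⟩
      rw [hgr μ (hV2 hμ.1) ν (hV2 hν), hlr] at h
      have e1 : φ + cst c - φp = φ - (φp - cst c) := by abel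
      have e2 : l2 (τ⁻¹ • (φ - (φp - cst c))) 1 = 0 := by
        rw [l2_smul_left hb, l2_sub_left hb, hφ.2, l2_sub_cst_mean hΩ, sub_zero, mul_zero]
      rw [hT.gradIP_add_cst (hV2 hμ.1) (hV2 hν), e1, h, e2]
      ring
    · simp only [lift]
      have h := h1 (ψ - cst (mean ψ)) (sub_cst_mean_mem_Z₀ hΩ hψ)
      set u := φ + cst c
      rw [har φ hφ.1 ψ hψ, hgr _ (sub_cst_mem 2 hφp2 c) ψ hψ, hgp ψ hψ, hlr, hlr, hlr, hμ.2] at h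
      have e1 := mean_mul_volume hΩ (u ^ 3 + (1 - ε) • u)
      rw [hF] at e1
      rw [hT.aIP_add_cst α hφ.1 hψ, l2_add_left hb μ, l2_cst_left hb, ← mean_mul_volume hΩ ψ, hF]
      -- The constant part of the test function contributes `mean ψ` times the integral of the
      -- nonlinearity, and the shift of `μ` by that nonlinearity's mean balances it.
      linear_combination h - mean ψ * e1
  · rintro ⟨φ, μ⟩ - ⟨φ', μ'⟩ - h
    simp only [lift, Prod.mk.injEq] at h
    obtain ⟨ha, hm⟩ := h
    obtain rfl := add_right_cancel ha
    obtain rfl := add_right_cancel hm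
    rfl
  · rintro ⟨u, ν⟩ ⟨hu, hν, h1, h2⟩
    simp only at hu hν h1 h2
    have h1V : (1 : C(closure Ω, ℝ)) ∈ T.feSubmodule 1 := by
      have := T.cst_mem_feSubmodule 1 1
      rwa [cst_eq_smul, one_smul] at this
    have hg1 : ∀ v, T.gradIP v 1 = 0 := fun v => by
      have := gradIP_cst (T := T) 1 v
      rwa [cst_eq_smul, one_smul, gradIP_comm] at this
    have ha1 : ∀ v, T.aIP α v 1 = 0 := fun v => by
      have := aIP_cst (T := T) α 1 v
      rwa [cst_eq_smul, one_smul, aIP_comm] at this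
    -- Conservation of mass, from the test function `1` in the first equation.
    have hmass : l2 u 1 = l2 φp 1 := by
      have h := h1 1 h1V
      rw [hg1, add_zero, l2_smul_left hb, l2_sub_left hb] at h
      exact sub_eq_zero.1 ((mul_eq_zero.1 h).resolve_left (inv_ne_zero hτ.ne'))
    have hmu : mean u = c := by rw [hc, mean, mean, hmass]
    -- The test function `1` in the second equation fixes the mean of the chemical potential.
    have hmean : l2 (u ^ 3 + (1 - ε) • u) 1 = l2 ν 1 := by
      have h := h2 1 (T.V_subset_Z h1V)
      rw [ha1, hg1] at h
      linarith
    set m := mean (u ^ 3 + (1 - ε) • u) with hm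
    have hmν : m = mean ν := by rw [hm, mean, mean, hmean]
    have hφ : u - cst c ∈ T.Z₀ := by rw [← hmu]; exact sub_cst_mean_mem_Z₀ hΩ hu
    have hμ : ν - cst m ∈ T.V₀ := by
      rw [hmν]
      exact ⟨sub_cst_mem 1 hν _, l2_sub_cst_mean hΩ ν⟩
    refine ⟨(u - cst c, ν - cst m), ⟨hφ, hμ, fun ψ hψ => ?_, fun η hη => ?_⟩, ?_⟩
    · have h := h2 ψ hψ.1
      have ha := har ψ hψ.1 u hu c
      rw [hF] at h
      simp only [sub_add_cancel]
      rw [aIP_comm, ha, aIP_comm, hgp ψ hψ.1, l2_sub_left hb ν, l2_cst_left hb, hψ.2]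
      linear_combination h
    · have h := h1 η hη.1
      have hg := hgr η (hV2 hη.1) ν (hV2 hν) m
      simp only
      have e1 : u - cst c - (φp - cst c) = u - φp := by abel
      rw [gradIP_comm, hg, gradIP_comm, e1]
      linear_combination h
    · simp only [lift, sub_add_cancel]
      rw [← hm, sub_add_cancel]

end Triangulation

/-! ### The main theorem. -/

theorem mainTheorem2 (σ : ℝ) :
    ∃ α₀ : ℝ, 1 ≤ α₀ ∧
      ∀ (Ω : Set Plane), IsPolygonalDomain Ω → ∀ T : Triangulation Ω, T.ShapeRegular σ →
      ∀ α τ ε : ℝ, α₀ ≤ α → 0 < τ → ε < 1 →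
        -- the scheme has exactly one solution
        (∀ φp ∈ T.Z, ∃! s, s ∈ T.schemeSolutions α τ ε φp) ∧
        -- the mean-zero scheme has exactly one solution
        (∀ φp ∈ T.Z₀, ∀ c : ℝ, ∃! s, s ∈ T.meanZeroSolutions α τ ε c φp) ∧
        -- the two schemes are equivalent
        (∀ φp ∈ T.Z, Set.BijOn (Triangulation.lift ε (mean φp))
          (T.meanZeroSolutions α τ ε (mean φp) (φp - cst (mean φp)))
          (T.schemeSolutions α τ ε φp)) ∧
        -- strict convexity, coercivity and unique minimizer of the functional
        (∀ X : Set C(closure Ω, ℝ), X = T.V₀ ∨ X = T.Z₀ →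
          (∀ ζ ∈ T.Z₀, ∃! χ, T.IsInvLaplacian X ζ χ) ∧
          ∀ φp ∈ T.Z₀, ∀ c : ℝ,
            StrictConvexOn ℝ T.Z₀ (T.G X α τ ε c φp) ∧
            (∃ γ β : ℝ, 0 < γ ∧ 0 ≤ β ∧
              ∀ φ ∈ T.Z₀, γ * T.norm2hSq α φ - β ≤ T.G X α τ ε c φp φ) ∧
            ∃! φ, φ ∈ T.Z₀ ∧ IsMinOn (T.G X α τ ε c φp) T.Z₀ φ) ∧
        -- minimizing the functional is the same as solving the mean-zero scheme
        (∀ φp ∈ T.Z₀, ∀ c : ℝ, ∀ φ ∈ T.Z₀,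
          (∃! μ, μ ∈ T.V₀ ∧ T.MeanZeroEqMu τ φp φ μ) ∧
          ∀ μ ∈ T.V₀, T.MeanZeroEqMu τ φp φ μ →
            (IsMinOn (T.G T.V₀ α τ ε c φp) T.Z₀ φ ↔ T.MeanZeroEqPhi α ε c φp φ μ)) := by
  refine ⟨2 * (24 * σ ^ 2 + 1), by nlinarith [sq_nonneg σ], ?_⟩
  intro Ω hΩ T hT α τ ε hα hτ hε
  have hbij : ∀ φp ∈ T.Z, Set.BijOn (Triangulation.lift ε (mean φp))
      (T.meanZeroSolutions α τ ε (mean φp) (φp - cst (mean φp))) (T.schemeSolutions α τ ε φp) :=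
    fun φp hφp => hT.bijOn_lift hΩ α hτ ε hφp
  have hsol : ∀ φp ∈ T.Z₀, ∀ c : ℝ, ∃! s, s ∈ T.meanZeroSolutions α τ ε c φp :=
    fun φp hφp c => hT.existsUnique_meanZeroSolution hΩ hα hτ hε hφp c
  refine ⟨fun φp hφp => ?_, hsol, hbij, fun X hX => ⟨fun ζ _ => ?_, fun φp hφp c =>
    hT.energy_convex_coercive hΩ hX hα hτ hε hφp c⟩, fun φp hφp c φ hφ =>
    ⟨hT.existsUnique_meanZeroEqMu hΩ φp φ, fun μ hμ hμφ =>
      hT.isMinOn_iff_meanZeroEqPhi hΩ hα hτ hε hφp c hφ hμ hμφ⟩⟩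
  -- Unique solvability of the full scheme is transported from the mean-zero scheme through the
  -- bijection.
  · obtain ⟨s, hs, huniq⟩ := hsol _ (Triangulation.sub_cst_mean_mem_Z₀ hΩ hφp) (mean φp)
    refine ⟨_, (hbij φp hφp).mapsTo hs, fun s' hs' => ?_⟩
    obtain ⟨s₀, hs₀, rfl⟩ := (hbij φp hφp).surjOn hs'
    rw [huniq s₀ hs₀]
  · obtain ⟨X, rfl, hX'⟩ := Triangulation.exists_submodule_of_eq hΩ hX
    exact hT.existsUnique_isInvLaplacian hΩ hX' ζ
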